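/- Let $\mathbb N=\{0,1,2,\dots\}$. For a rooted tree $T$ let $T_n$ be the set of nodes at distance $n$ from the root, and let $\mathrm{wid}(T)=\sup_{n\ge 0}|T_n|$, $\mathrm{ht}(T)=\sup\{n\ge 0: T_n\neq\emptyset\}$, and let $|T|$ be the number of nodes of $T$; each of these may be $+\infty$. For a probability measure $\mu$ on $\mathbb N$ we write $\mu(1)=\mu(\{1\})$, and $T\sim\mathrm{GW}(\mu)$ means that $T$ is a Galton–Watson tree with offspring distribution $\mu$: each node has a random, $\mu$-distributed number of children, and these numbers are independent for distinct nodes. **Theorem.** There exists an absolute constant $C>0$ such that for every probability measure $\mu$ on $\mathbb N$, for $T\sim\mathrm{GW}(\mu)$, and for every real $x\ge 1$, $$\mathbb P\left(\mathrm{ht}(T) > C x\,\frac{\mathrm{wid}(T)}{1-\mu(1)}\right)\le e^{-x} \qquad\text{and}\qquad \mathbb P\left(\mathrm{ht}(T) > C x\left(\frac{|T|}{1-\mu(1)}\right)^{1/2}\right)\le e^{-x^2}.$$ Both sides of the inequalities between random quantities are taken in $[0,\infty]$; if $\mu(1)=1$, the quotients with denominator $1-\mu(1)=0$ are read as $+\infty$.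 -/

import Mathlib

open MeasureTheory
open scoped ENNReal

/-- A rooted plane tree, seen as a subtree of the Ulam-Harris tree. Its nodes are finite words over
`ℕ`; the root is the empty word, the parent of `u ++ [j]` is `u`, and the children of a node `u` are
`u ++ [0], u ++ [1], …` in this order, without gaps. -/
@[ext]
structure PlaneTree where
  nodes : Set (List ℕ)
  root_mem : [] ∈ nodes
  parent_mem : ∀ (u : List ℕ) (j : ℕ), u ++ [j] ∈ nodes → u ∈ nodes
  sibling_mem : ∀ (u : List ℕ) (i j : ℕ), i ≤ j → u ++ [j] ∈ nodes → u ++ [i] ∈ nodes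

namespace PlaneTree

/-- The set of nodes at distance `n` from the root. -/
def generation (T : PlaneTree) (n : ℕ) : Set (List ℕ) := {u | u ∈ T.nodes ∧ u.length = n}

/-- The width: the supremum over `n` of the number of nodes at distance `n` from the root. -/
noncomputable def width (T : PlaneTree) : ℕ∞ := ⨆ n : ℕ, (T.generation n).encard

/-- The height: the supremum of all `n` such that some node has distance `n` from the root. -/
noncomputable def height (T : PlaneTree) : ℕ∞ :=
  ⨆ (n : ℕ) (_ : (T.generation n).Nonempty), (n : ℕ∞)

/-- The volume: the number of nodes. -/
noncomputable def volume (T : PlaneTree) : ℕ∞ := T.nodes.encard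

/-- The σ-algebra on trees generated by the events `u ∈ T`, for `u` a word. -/
instance : MeasurableSpace PlaneTree := MeasurableSpace.comap PlaneTree.nodes inferInstance

/-- The tree in which each node `u` has exactly `ξ u` children. -/
def ofOffspring (ξ : List ℕ → ℕ) : PlaneTree where
  nodes := {u | ∀ (v : List ℕ) (j : ℕ), v ++ [j] <+: u → j < ξ v}
  root_mem := by
    intro v j h
    simp at h
  parent_mem := by
    intro u j h v k hv
    exact h v k (hv.trans (List.prefix_append u [j]))
  sibling_mem := by
    intro u i j hij h v k hv
    rw [List.prefix_concat_iff] at hv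
    rcases hv with hv | hv
    · obtain ⟨rfl, hk⟩ := List.append_inj' hv rfl
      obtain rfl : k = i := by simpa using hk
      exact lt_of_le_of_lt hij (h v j (List.prefix_refl _))
    · exact h v k (hv.trans (List.prefix_append u [j]))

theorem measurable_ofOffspring : Measurable ofOffspring := by
  rw [measurable_comap_iff]
  refine measurable_set_iff.2 fun u => ?_
  refine measurableSet_setOfPred.1 ?_
  have h : {ξ : List ℕ → ℕ | u ∈ (nodes ∘ ofOffspring) ξ}
      = ⋂ (v : List ℕ) (j : ℕ) (_ : v ++ [j] <+: u), {ξ | j < ξ v} := by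
    ext ξ
    simp [ofOffspring]
  rw [h]
  refine MeasurableSet.iInter fun v => MeasurableSet.iInter fun j =>
    MeasurableSet.iInter fun _ => ?_
  exact measurableSet_lt measurable_const (measurable_pi_apply v)

end PlaneTree

/-- The law `GW(μ)` of a Galton-Watson tree with offspring distribution `μ`: the law of the tree in
which each node `u` has `ξ u` children, where the random variables `ξ u` are independent with
distribution `μ`. -/
noncomputable def galtonWatson (μ : Measure ℕ) [IsProbabilityMeasure μ] : Measure PlaneTree :=
  (Measure.infinitePi fun _ : List ℕ => μ).map PlaneTree.ofOffspring

instance (μ : Measure ℕ) [IsProbabilityMeasure μ] : IsProbabilityMeasure (galtonWatson μ) :=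
  Measure.isProbabilityMeasure_map PlaneTree.measurable_ofOffspring.aemeasurable

open ProbabilityTheory

namespace GaltonWatson

/-! Write Z_n for the size of generation n, f for the generating function and δ = 1 - μ(1). Let q be
the least r in [0,1] with f(r) ≤ r. It is a fixed point, and convexity gives f(q(1-s)) ≥ q(1 - s +
δs²/2) (`exists_fixedPoint`). Since q^{Z_n} has constant expectation q, it can serve as a weight,
under which the process drifts at most like a critical one, whatever the mean of μ. The quadratic
gap says that 1 - (1-s)^Z then decreases in expectation, by order δs when Z is about 1/s. Summing
over dyadic s with weights of order 1/(δs) yields a function V of size at most order 2^k/δ which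
loses at least 1 at each step from [1, 2^k], but starts at only order (k+1)/δ
(`lyapunovStep_add_le`, `integral_lyapunov_genSize_succ_le`).

With η of order δ/2^k, this bounds the expectation of (1+η/2)^N (1+ηV(Z_n)) q^{Z_n} by q(1+ηV(1)),
where N is the time spent in [1, 2^k] (`integral_occupation_le`). Subtracting the constant q before
applying Markov's inequality leaves ηV(1) = (k+1)/(4·2^k), which is summable in k. Hence one
exceptional event serves all levels at once (`measure_exists_occupation_le`), and the level may
depend on the tree.

For the width, take 2^k comparable to wid(T): all generations before extinction count. For the
volume, take 2^k comparable to |T|/ht(T): at least about half of them count, so a large height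
forces a long occupation, with x² in the role of x. A surviving tree has infinite volume, and almost
surely infinite width (`measure_forall_genSize_mem`). -/

/-! ### Generations as finite sets of words -/

/-- The nodes of generation `n` of the tree with offspring numbers `ξ`. -/
def gen (ξ : List ℕ → ℕ) : ℕ → Finset (List ℕ)
  | 0 => {[]}
  | n + 1 => (gen ξ n).biUnion fun u => (Finset.range (ξ u)).image fun j => u ++ [j]

/-- The size of generation `n` of the tree with offspring numbers `ξ`. -/
def genSize (ξ : List ℕ → ℕ) (n : ℕ) : ℕ := (gen ξ n).card

theorem append_mem_nodes_iff (ξ : List ℕ → ℕ) (v : List ℕ) (j : ℕ) :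
    v ++ [j] ∈ (PlaneTree.ofOffspring ξ).nodes ↔
      v ∈ (PlaneTree.ofOffspring ξ).nodes ∧ j < ξ v := by
  refine ⟨fun h => ⟨PlaneTree.parent_mem _ v j h, h v j (List.prefix_refl _)⟩, ?_⟩
  rintro ⟨h1, h2⟩ u k hu
  rw [List.prefix_concat_iff] at hu
  rcases hu with hu | hu
  · obtain ⟨rfl, hk⟩ := List.append_inj' hu rfl
    obtain rfl : k = j := by simpa using hk
    exact h2
  · exact h1 u k hu

theorem mem_gen (ξ : List ℕ → ℕ) (n : ℕ) (u : List ℕ) :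
    u ∈ gen ξ n ↔ u ∈ (PlaneTree.ofOffspring ξ).generation n := by
  induction n generalizing u with
  | zero =>
    simp only [gen, Finset.mem_singleton, PlaneTree.generation, Set.mem_ofPred_eq,
      List.length_eq_zero_iff]
    exact ⟨fun h => ⟨h ▸ PlaneTree.root_mem _, h⟩, fun h => h.2⟩
  | succ n ih =>
    simp only [gen, Finset.mem_biUnion, Finset.mem_image, Finset.mem_range, ih]
    constructor
    · rintro ⟨v, ⟨hv, hl⟩, j, hj, rfl⟩
      exact ⟨(append_mem_nodes_iff ξ v j).2 ⟨hv, hj⟩, by simp [hl]⟩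
    · rintro ⟨hu, hl⟩
      rcases List.eq_nil_or_concat' u with rfl | ⟨v, j, rfl⟩
      · simp at hl
      · have := (append_mem_nodes_iff ξ v j).1 hu
        exact ⟨v, ⟨this.1, by simpa using hl⟩, j, this.2, rfl⟩

theorem coe_gen (ξ : List ℕ → ℕ) (n : ℕ) :
    (gen ξ n : Set (List ℕ)) = (PlaneTree.ofOffspring ξ).generation n :=
  Set.ext fun u => mem_gen ξ n u

theorem length_of_mem_gen {ξ : List ℕ → ℕ} {n : ℕ} {u : List ℕ} (h : u ∈ gen ξ n) :
    u.length = n :=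
  ((mem_gen ξ n u).1 h).2

theorem encard_generation (ξ : List ℕ → ℕ) (n : ℕ) :
    ((PlaneTree.ofOffspring ξ).generation n).encard = genSize ξ n := by
  rw [← coe_gen, Set.encard_coe_eq_coe_finsetCard, genSize]

theorem genSize_zero (ξ : List ℕ → ℕ) : genSize ξ 0 = 1 := rfl

theorem genSize_succ (ξ : List ℕ → ℕ) (n : ℕ) :
    genSize ξ (n + 1) = ∑ u ∈ gen ξ n, ξ u := by
  rw [genSize, gen, Finset.card_biUnion]
  · refine Finset.sum_congr rfl fun u _ => ?_
    rw [Finset.card_image_of_injective _ fun i j h => by simpa using h, Finset.card_range]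
  · intro u _ v _ huv
    rw [Function.onFun, Finset.disjoint_left]
    intro w hw hw'
    simp only [Finset.mem_image] at hw hw'
    obtain ⟨i, -, rfl⟩ := hw
    obtain ⟨j, -, h⟩ := hw'
    exact huv (List.append_inj' h rfl).1.symm

theorem genSize_succ_eq_zero {ξ : List ℕ → ℕ} {n : ℕ} (h : genSize ξ n = 0) :
    genSize ξ (n + 1) = 0 := by
  rw [genSize, Finset.card_eq_zero] at h
  simp [genSize_succ, h]

theorem sum_genSize_le_volume (ξ : List ℕ → ℕ) (n : ℕ) :
    ((∑ i ∈ Finset.range n, genSize ξ i : ℕ) : ℕ∞) ≤ (PlaneTree.ofOffspring ξ).volume := by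
  have h : (∑ i ∈ Finset.range n, genSize ξ i) = ((Finset.range n).biUnion (gen ξ)).card := by
    rw [Finset.card_biUnion]
    · rfl
    · intro i _ j _ hij
      rw [Function.onFun, Finset.disjoint_left]
      intro u hu hu'
      exact hij ((length_of_mem_gen hu).symm.trans (length_of_mem_gen hu'))
  rw [h, ← Set.encard_coe_eq_coe_finsetCard]
  refine Set.encard_le_encard fun u hu => ?_
  simp only [Finset.coe_biUnion, Set.mem_iUnion] at hu
  obtain ⟨i, -, hu⟩ := hu
  exact ((mem_gen ξ i u).1 hu).1

/-! ### Information carried by the first generations -/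

/-- The σ-algebra generated by the offspring numbers of the words of length in `s`. -/
abbrev offspringSigma (s : Set ℕ) : MeasurableSpace (List ℕ → ℕ) :=
  ⨆ u ∈ {u : List ℕ | u.length ∈ s}, MeasurableSpace.comap (fun ξ => ξ u) inferInstance

theorem measurable_eval_offspringSigma {s : Set ℕ} {u : List ℕ} (hu : u.length ∈ s) :
    Measurable[offspringSigma s] fun ξ : List ℕ → ℕ => ξ u :=
  measurable_iff_comap_le.2
    (le_iSup₂ (f := fun (u : List ℕ) (_ : u ∈ {u : List ℕ | u.length ∈ s}) =>
      MeasurableSpace.comap (fun ξ : List ℕ → ℕ => ξ u) inferInstance) u hu)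

theorem offspringSigma_le (s : Set ℕ) : offspringSigma s ≤ MeasurableSpace.pi :=
  iSup₂_le fun u _ => measurable_iff_comap_le.1 (measurable_pi_apply u)

theorem offspringSigma_mono {s t : Set ℕ} (h : s ⊆ t) : offspringSigma s ≤ offspringSigma t :=
  iSup₂_le fun _ hu => measurable_iff_comap_le.1 (measurable_eval_offspringSigma (h hu))

/-- Membership of a word of length `n` in the tree depends only on the offspring numbers of its
proper prefixes, which are shorter than `n`. -/
theorem measurableSet_gen_eq (n : ℕ) (S : Finset (List ℕ)) :
    MeasurableSet[offspringSigma (Set.Iio n)] {ξ | gen ξ n = S} := by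
  let _ : MeasurableSpace (List ℕ → ℕ) := offspringSigma (Set.Iio n)
  have hmem : ∀ u : List ℕ, MeasurableSet {ξ | u ∈ gen ξ n} := by
    intro u
    by_cases hu : u.length = n
    · have h : {ξ | u ∈ gen ξ n}
          = ⋂ (v : List ℕ) (j : ℕ) (_ : v ++ [j] <+: u), {ξ | j < ξ v} := by
        ext ξ
        simp [mem_gen, PlaneTree.generation, hu, PlaneTree.ofOffspring]
      rw [h]
      refine MeasurableSet.iInter fun v => MeasurableSet.iInter fun j =>
        MeasurableSet.iInter fun hv => ?_
      have hl := hv.length_le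
      rw [List.length_append, List.length_singleton] at hl
      exact measurableSet_lt measurable_const
        (measurable_eval_offspringSigma (s := Set.Iio n) (Set.mem_Iio.2 (by omega)))
    · have h : {ξ | u ∈ gen ξ n} = ∅ :=
        Set.eq_empty_of_forall_notMem fun ξ h => hu (length_of_mem_gen h)
      rw [h]
      exact MeasurableSet.empty
  have h : {ξ | gen ξ n = S} = ⋂ u : List ℕ, {ξ | u ∈ gen ξ n ↔ u ∈ S} := by
    ext ξ
    simp [Finset.ext_iff]
  rw [h]
  refine MeasurableSet.iInter fun u => ?_
  by_cases hu : u ∈ S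
  · simpa [hu] using hmem u
  · simp only [hu, iff_false]
    exact (hmem u).compl

theorem measurable_genSize_offspringSigma (n : ℕ) :
    Measurable[offspringSigma (Set.Iio n)] fun ξ => genSize ξ n := by
  let _ : MeasurableSpace (List ℕ → ℕ) := offspringSigma (Set.Iio n)
  refine measurable_to_countable' fun z => ?_
  have h : (fun ξ => genSize ξ n) ⁻¹' {z}
      = ⋃ (S : Finset (List ℕ)) (_ : S.card = z), {ξ | gen ξ n = S} := by
    ext ξ
    simp [genSize]
  rw [h]
  exact MeasurableSet.iUnion fun S => MeasurableSet.iUnion fun _ => measurableSet_gen_eq n S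

theorem measurable_genSize (n : ℕ) : Measurable fun ξ => genSize ξ n :=
  (measurable_genSize_offspringSigma n).mono (offspringSigma_le _) le_rfl

/-! ### The branching property -/

/-- The law of the independent offspring numbers. -/
noncomputable abbrev offspringLaw (μ : Measure ℕ) [IsProbabilityMeasure μ] :
    Measure (List ℕ → ℕ) :=
  Measure.infinitePi fun _ : List ℕ => μ

variable (μ : Measure ℕ) [IsProbabilityMeasure μ]

theorem indep_offspringSigma {s t : Set ℕ} (h : Disjoint s t) :
    Indep (offspringSigma s) (offspringSigma t) (offspringLaw μ) := by
  refine indep_iSup_of_disjoint (fun u => measurable_iff_comap_le.1 (measurable_pi_apply u)) ?_ ?_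
  · exact iIndepFun_infinitePi (P := fun _ : List ℕ => μ) (X := fun _ k => k)
      (fun _ => measurable_id)
  · exact Set.disjoint_left.2 fun u hu hu' => Set.disjoint_left.1 h hu hu'

theorem lintegral_prod_pow (S : Finset (List ℕ)) (r : ℝ≥0∞) :
    ∫⁻ ξ, ∏ u ∈ S, r ^ ξ u ∂offspringLaw μ = (∫⁻ k, r ^ k ∂μ) ^ S.card := by
  have hm : Measurable fun k : ℕ => r ^ k := measurable_of_countable _
  rw [lintegral_prod_eq_prod_lintegral_of_indepFun S (fun u (ξ : List ℕ → ℕ) => r ^ ξ u)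
    (iIndepFun_infinitePi (P := fun _ : List ℕ => μ) (X := fun _ k => r ^ k) fun _ => hm)
    (fun u => hm.comp (measurable_pi_apply u)), ← Finset.prod_const]
  refine Finset.prod_congr rfl fun u _ => ?_
  rw [← (measurePreserving_eval_infinitePi (fun _ : List ℕ => μ) u).lintegral_comp hm]

/-- The branching property, for generating functions. -/
theorem lintegral_mul_pow_genSize_succ {n : ℕ} {X : (List ℕ → ℕ) → ℝ≥0∞}
    (hX : Measurable[offspringSigma (Set.Iio n)] X) (r : ℝ≥0∞) :
    ∫⁻ ξ, X ξ * r ^ genSize ξ (n + 1) ∂offspringLaw μ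
      = ∫⁻ ξ, X ξ * (∫⁻ k, r ^ k ∂μ) ^ genSize ξ n ∂offspringLaw μ := by
  -- Split according to the value `S` of generation `n`. On each piece the next size is the sum of
  -- `ξ u` over the words `u ∈ S` of length `n`, which is independent of `X`.
  have hS : ∀ S, MeasurableSet {ξ | gen ξ n = S} := fun S =>
    offspringSigma_le _ _ (measurableSet_gen_eq n S)
  have hU : (⋃ S, {ξ | gen ξ n = S}) = Set.univ := by
    ext ξ
    simp
  have hD : Pairwise (Function.onFun Disjoint fun S => {ξ | gen ξ n = S}) := by
    intro S S' hne
    refine Set.disjoint_left.2 fun ξ h h' => hne ?_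
    exact Eq.trans (Eq.symm h) h'
  rw [← setLIntegral_univ, ← hU, lintegral_iUnion hS hD, ← setLIntegral_univ (fun ξ => X ξ * _),
    ← hU, lintegral_iUnion hS hD]
  refine tsum_congr fun S => ?_
  by_cases hl : ∀ u ∈ S, u.length = n
  · have hY : Measurable[offspringSigma (Set.Iio n)] ({ξ | gen ξ n = S}.indicator X) :=
      Measurable.indicator hX (measurableSet_gen_eq n S)
    have hG : Measurable[offspringSigma {n}] fun ξ : List ℕ → ℕ => ∏ u ∈ S, r ^ ξ u := by
      let _ : MeasurableSpace (List ℕ → ℕ) := offspringSigma {n}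
      refine Finset.measurable_prod S fun u hu => ?_
      exact (measurable_of_countable fun k : ℕ => r ^ k).comp
        (measurable_eval_offspringSigma (s := {n}) (hl u hu))
    have e1 : ∫⁻ ξ in {ξ | gen ξ n = S}, X ξ * r ^ genSize ξ (n + 1) ∂offspringLaw μ
        = ∫⁻ ξ, {ξ | gen ξ n = S}.indicator X ξ * ∏ u ∈ S, r ^ ξ u ∂offspringLaw μ := by
      rw [← lintegral_indicator (hS S)]
      refine lintegral_congr fun ξ => ?_
      by_cases hξ : gen ξ n = S
      · rw [Set.indicator_of_mem (by exact hξ), Set.indicator_of_mem (by exact hξ), genSize_succ,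
          hξ, Finset.prod_pow_eq_pow_sum]
      · rw [Set.indicator_of_notMem (by exact hξ), Set.indicator_of_notMem (by exact hξ), zero_mul]
    have e2 : ∫⁻ ξ in {ξ | gen ξ n = S}, X ξ * (∫⁻ k, r ^ k ∂μ) ^ genSize ξ n ∂offspringLaw μ
        = ∫⁻ ξ, {ξ | gen ξ n = S}.indicator X ξ * (∫⁻ k, r ^ k ∂μ) ^ S.card ∂offspringLaw μ := by
      rw [← lintegral_indicator (hS S)]
      refine lintegral_congr fun ξ => ?_
      by_cases hξ : gen ξ n = S
      · rw [Set.indicator_of_mem (by exact hξ), Set.indicator_of_mem (by exact hξ), genSize, hξ]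
      · rw [Set.indicator_of_notMem (by exact hξ), Set.indicator_of_notMem (by exact hξ), zero_mul]
    rw [e1, e2, lintegral_mul_eq_lintegral_mul_lintegral_of_independent_measurableSpace
      (offspringSigma_le _) (offspringSigma_le _)
      (indep_offspringSigma μ (s := Set.Iio n) (t := {n}) (by simp)) hY hG, lintegral_prod_pow,
      lintegral_mul_const _ (hY.mono (offspringSigma_le _) le_rfl)]
  · have h : {ξ | gen ξ n = S} = ∅ := by
      refine Set.eq_empty_of_forall_notMem fun ξ h => hl fun u hu => ?_
      exact length_of_mem_gen (ξ := ξ) (by rw [show gen ξ n = S from h]; exact hu)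
    simp [h]

/-! ### The generating function and its fixed point -/

/-- The probability generating function. -/
noncomputable def pgf (r : ℝ) : ℝ := ∫ k, r ^ k ∂μ

variable {μ}

theorem integrable_pow {r : ℝ} (h0 : 0 ≤ r) (h1 : r ≤ 1) : Integrable (fun k : ℕ => r ^ k) μ := by
  refine Integrable.of_bound (C := 1) (measurable_of_countable _).aestronglyMeasurable
    (Filter.Eventually.of_forall fun k => ?_)
  rw [Real.norm_of_nonneg (pow_nonneg h0 k)]
  exact pow_le_one₀ h0 h1

theorem pgf_nonneg {μ : Measure ℕ} {r : ℝ} (h0 : 0 ≤ r) : 0 ≤ pgf μ r :=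
  integral_nonneg fun k => pow_nonneg h0 k

theorem pgf_one : pgf μ 1 = 1 := by simp [pgf]

theorem continuousOn_pgf : ContinuousOn (pgf μ) (Set.Icc 0 1) := by
  refine continuousOn_of_dominated (bound := fun _ => 1) ?_ ?_ (integrable_const 1) ?_
  · exact fun r _ => (measurable_of_countable _).aestronglyMeasurable
  · refine fun r hr => Filter.Eventually.of_forall fun k => ?_
    rw [Real.norm_of_nonneg (pow_nonneg hr.1 k)]
    exact pow_le_one₀ hr.1 hr.2
  · exact Filter.Eventually.of_forall fun k => (continuous_pow k).continuousOn

/-- Convexity of the power: the tangent at r lies below the chord from r to q. -/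
theorem mul_pow_pred_mul_sub_le {r q : ℝ} (h0 : 0 ≤ r) (h : r ≤ q) (k : ℕ) :
    k * r ^ (k - 1) * (q - r) ≤ q ^ k - r ^ k := by
  induction k with
  | zero => simp
  | succ k ih =>
    rcases k with _ | k
    · simp
    · simp only [Nat.add_sub_cancel] at ih ⊢
      have h1 : 0 ≤ ((k + 1 : ℕ) : ℝ) * r ^ k * (q - r) * (q - r) := by
        have := sub_nonneg.2 h
        positivity
      have h2 := mul_le_mul_of_nonneg_left ih (h0.trans h)
      push_cast at *
      rw [pow_succ q (k + 1), pow_succ r (k + 1)]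
      rw [pow_succ r k] at *
      nlinarith

/-- The quadratic coefficient k(k-1)/2 is at least k/2 once k ≥ 2. The failure at k = 1 is the
source of the factor 1 - μ(1). -/
theorem one_sub_mul_add_le_pow {s : ℝ} (h1 : s ≤ 1) {k : ℕ} (hk : k ≠ 1) :
    1 - k * s + k * (s ^ 2 / 2) ≤ (1 - s) ^ k := by
  rcases k with _ | _ | k
  · simp
  · exact absurd rfl hk
  · clear hk
    induction k with
    | zero =>
      norm_num
      nlinarith
    | succ k ih =>
      have h2 := mul_le_mul_of_nonneg_right ih (sub_nonneg.2 h1)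
      rw [pow_succ]
      refine le_trans ?_ h2
      push_cast
      have h3 : 0 ≤ s ^ 2 * ((1 - s) * (k + 2) + (k + 1)) := by
        have := sub_nonneg.2 h1
        positivity
      nlinarith

/-- The previous bound times r^k, with an indicator repairing k = 1. Integrated, it relates f(r),
f(r(1-s)), f'(r) and μ(1). -/
theorem pow_le_pow_mul_add {r s : ℝ} (hr : 0 ≤ r) (h1 : s ≤ 1) (k : ℕ) :
    r ^ k ≤ (r * (1 - s)) ^ k + (s - s ^ 2 / 2) * r * (k * r ^ (k - 1))
      + s ^ 2 / 2 * r * ({1} : Set ℕ).indicator 1 k := by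
  by_cases hk : k = 1
  · subst hk
    simp
    nlinarith
  · have h := mul_le_mul_of_nonneg_left (one_sub_mul_add_le_pow h1 hk) (pow_nonneg hr k)
    rw [mul_pow]
    have e : r * (k * r ^ (k - 1)) = k * r ^ k := by
      rcases k with _ | k
      · simp
      · rw [Nat.add_sub_cancel, pow_succ]
        ring
    rw [Set.indicator_of_notMem (by simpa using hk), mul_assoc (s - s ^ 2 / 2), e]
    nlinarith

/-- The chord of f from r to q has slope at most 1, because r ≤ f(r) and f(q) ≤ q; by convexity
f'(r) ≤ 1. Staying strictly left of q makes f'(r) finite with no moment assumption on μ. -/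
theorem le_pgf_mul_one_sub_of_lt {r q s : ℝ} (hr0 : 0 ≤ r) (hrq : r < q) (hq1 : q ≤ 1)
    (hr : r ≤ pgf μ r) (hq : pgf μ q ≤ q) (h0 : 0 ≤ s) (h1 : s ≤ 1) :
    r * (1 - s + (1 - μ.real {1}) * (s ^ 2 / 2)) ≤ pgf μ (r * (1 - s)) := by
  have hir := integrable_pow (μ := μ) hr0 (hrq.le.trans hq1)
  have hiq := integrable_pow (μ := μ) (hr0.trans hrq.le) hq1
  have his := integrable_pow (μ := μ) (mul_nonneg hr0 (sub_nonneg.2 h1))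
    (mul_le_one₀ (hrq.le.trans hq1) (sub_nonneg.2 h1) (by linarith))
  have hiD : Integrable (fun k : ℕ => (k : ℝ) * r ^ (k - 1) * (q - r)) μ := by
    refine (hiq.sub hir).mono' (measurable_of_countable _).aestronglyMeasurable
      (Filter.Eventually.of_forall fun k => ?_)
    rw [Real.norm_of_nonneg (by have := sub_nonneg.2 hrq.le; positivity)]
    exact mul_pow_pred_mul_sub_le hr0 hrq.le k
  have hiD' : Integrable (fun k : ℕ => (k : ℝ) * r ^ (k - 1)) μ :=
    (integrable_mul_const_iff (IsUnit.mk0 _ (sub_pos.2 hrq).ne') _).1 hiD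
  have hD : ∫ k : ℕ, (k : ℝ) * r ^ (k - 1) ∂μ ≤ 1 := by
    have h := integral_mono hiD (hiq.sub hir) fun k => mul_pow_pred_mul_sub_le hr0 hrq.le k
    simp only [Pi.sub_apply] at h
    rw [integral_mul_const, integral_sub hiq hir] at h
    change _ ≤ pgf μ q - pgf μ r at h
    nlinarith [sub_pos.2 hrq]
  have hi1 : Integrable (({1} : Set ℕ).indicator (1 : ℕ → ℝ)) μ :=
    (integrable_const 1).indicator (measurableSet_singleton 1)
  have hi2 : Integrable (fun k : ℕ => (r * (1 - s)) ^ k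
      + (s - s ^ 2 / 2) * r * (k * r ^ (k - 1))) μ := his.add (hiD'.const_mul _)
  have h := integral_mono hir (hi2.add (hi1.const_mul (s ^ 2 / 2 * r)))
    fun k => pow_le_pow_mul_add hr0 h1 k
  simp only [Pi.add_apply] at h
  rw [integral_add hi2 (hi1.const_mul _), integral_add his (hiD'.const_mul _), integral_const_mul,
    integral_const_mul, integral_indicator_one (measurableSet_singleton 1)] at h
  change pgf μ r ≤ pgf μ (r * (1 - s)) + _ + _ at h
  have h2 := mul_le_mul_of_nonneg_left hD
    (mul_nonneg (show 0 ≤ s - s ^ 2 / 2 by nlinarith) hr0)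
  nlinarith

variable (μ) in
/-- The generating function has a fixed point to the left of which it lies above the line of slope
one through this point, with a quadratic gap. -/
theorem exists_fixedPoint : ∃ q : ℝ, 0 ≤ q ∧ q ≤ 1 ∧ pgf μ q = q ∧
    ∀ s : ℝ, 0 ≤ s → s ≤ 1 →
      q * (1 - s + (1 - μ.real {1}) * (s ^ 2 / 2)) ≤ pgf μ (q * (1 - s)) := by
  have hcl : IsClosed {r ∈ Set.Icc (0 : ℝ) 1 | pgf μ r ≤ r} :=
    isClosed_Icc.isClosed_le continuousOn_pgf continuousOn_id
  have hc : IsCompact {r ∈ Set.Icc (0 : ℝ) 1 | pgf μ r ≤ r} :=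
    isCompact_Icc.of_isClosed_subset hcl fun r hr => hr.1
  obtain ⟨q, ⟨⟨hq0, hq1⟩, hq⟩, hmin⟩ := hc.exists_isLeast
    ⟨1, ⟨zero_le_one, le_rfl⟩, pgf_one.le⟩
  have key : ∀ s : ℝ, 0 ≤ s → s ≤ 1 →
      q * (1 - s + (1 - μ.real {1}) * (s ^ 2 / 2)) ≤ pgf μ (q * (1 - s)) := by
    intro s h0 h1
    rcases hq0.eq_or_lt with rfl | hq0
    · simpa using pgf_nonneg le_rfl
    have hs := sub_nonneg.2 h1
    have hcont : ContinuousOn (fun r => pgf μ (r * (1 - s))) (Set.Icc 0 1) := by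
      refine continuousOn_pgf.comp (by fun_prop) fun r hr => ⟨mul_nonneg hr.1 hs, ?_⟩
      exact mul_le_one₀ hr.2 hs (by linarith)
    have hsub : Set.Ico 0 q ⊆ Set.Icc (0 : ℝ) 1 := fun r hr => ⟨hr.1, hr.2.le.trans hq1⟩
    have hmem : q ∈ closure (Set.Ico 0 q) := by
      rw [closure_Ico hq0.ne]
      exact ⟨hq0.le, le_rfl⟩
    have hne : (nhdsWithin q (Set.Ico 0 q)).NeBot := mem_closure_iff_nhdsWithin_neBot.1 hmem
    -- Let r increase to q; by minimality of q, f(r) > r for every r < q.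
    refine le_of_tendsto_of_tendsto (b := nhdsWithin q (Set.Ico 0 q))
      (f := fun r => r * (1 - s + (1 - μ.real {1}) * (s ^ 2 / 2)))
      (Continuous.continuousWithinAt (by fun_prop))
      ((hcont q ⟨hq0.le, hq1⟩).mono_left (nhdsWithin_mono q hsub)) ?_
    filter_upwards [self_mem_nhdsWithin] with r hr
    refine le_pgf_mul_one_sub_of_lt hr.1 hr.2 hq1 ?_ hq h0 h1
    by_contra hlt
    exact absurd (hmin ⟨hsub hr, (not_le.1 hlt).le⟩) (not_le.2 hr.2)
  -- The missing inequality q ≤ f(q) is the gap inequality at s = 0.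
  refine ⟨q, hq0, hq1, le_antisymm hq ?_, key⟩
  simpa using key 0 le_rfl zero_le_one

/-- The branching property, for generating functions. -/
theorem integral_mul_pow_genSize_succ {n : ℕ} {X : (List ℕ → ℕ) → ℝ}
    (hX : Measurable[offspringSigma (Set.Iio n)] X) (hX0 : ∀ ξ, 0 ≤ X ξ) {r : ℝ} (h0 : 0 ≤ r)
    (h1 : r ≤ 1) :
    ∫ ξ, X ξ * r ^ genSize ξ (n + 1) ∂offspringLaw μ
      = ∫ ξ, X ξ * pgf μ r ^ genSize ξ n ∂offspringLaw μ := by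
  have hXm : Measurable X := hX.mono (offspringSigma_le _) le_rfl
  have hZ : ∀ (a : ℝ) (m : ℕ), Measurable fun ξ => X ξ * a ^ genSize ξ m := fun a m =>
    hXm.mul ((measurable_of_countable fun k : ℕ => a ^ k).comp (measurable_genSize m))
  rw [integral_eq_lintegral_of_nonneg_ae
      (Filter.Eventually.of_forall fun ξ => mul_nonneg (hX0 ξ) (pow_nonneg h0 _))
      (hZ r _).aestronglyMeasurable,
    integral_eq_lintegral_of_nonneg_ae
      (Filter.Eventually.of_forall fun ξ => mul_nonneg (hX0 ξ) (pow_nonneg (pgf_nonneg h0) _))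
      (hZ _ _).aestronglyMeasurable]
  congr 1
  have hf : ENNReal.ofReal (pgf μ r) = ∫⁻ k, ENNReal.ofReal r ^ k ∂μ := by
    rw [pgf, ofReal_integral_eq_lintegral_ofReal (integrable_pow h0 h1)
      (Filter.Eventually.of_forall fun k => pow_nonneg h0 k)]
    exact lintegral_congr fun k => ENNReal.ofReal_pow h0 k
  have hXe : Measurable[offspringSigma (Set.Iio n)] fun ξ => ENNReal.ofReal (X ξ) :=
    ENNReal.measurable_ofReal.comp hX
  simp only [ENNReal.ofReal_mul (hX0 _), ENNReal.ofReal_pow h0,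
    ENNReal.ofReal_pow (pgf_nonneg (μ := μ) h0), hf]
  exact lintegral_mul_pow_genSize_succ μ hXe _

/-! ### Occupation times -/

/-- The number of times before `n` at which the sequence `Z` lies in `[1, w]`. -/
def occupation (Z : ℕ → ℕ) (w n : ℕ) : ℕ :=
  ((Finset.range n).filter fun i => 1 ≤ Z i ∧ Z i ≤ w).card

theorem occupation_succ (Z : ℕ → ℕ) (w n : ℕ) :
    occupation Z w (n + 1) = occupation Z w n + if 1 ≤ Z n ∧ Z n ≤ w then 1 else 0 := by
  rw [occupation, occupation, Finset.range_add_one, Finset.filter_insert]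
  split_ifs with h
  · rw [Finset.card_insert_of_notMem (by simp)]
  · rfl

theorem occupation_le (Z : ℕ → ℕ) (w n : ℕ) : occupation Z w n ≤ n :=
  (Finset.card_filter_le _ _).trans_eq (Finset.card_range n)

/-- Z_n is determined by words shorter than `n`, so time `n` can be counted before the offspring of
generation `n` are revealed. This index shift is what allows the branching property to be applied
with an occupation factor. -/
theorem measurable_occupation_succ_offspringSigma (w n : ℕ) :
    Measurable[offspringSigma (Set.Iio n)] fun ξ => occupation (genSize ξ) w (n + 1) := by
  induction n with
  | zero =>
    have h : (fun ξ => occupation (genSize ξ) w (0 + 1))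
        = fun _ => if 1 ≤ 1 ∧ 1 ≤ w then 1 else 0 := by
      funext ξ
      rw [occupation_succ, genSize_zero]
      simp [occupation]
    rw [h]
    exact measurable_const
  | succ n ih =>
    let _ : MeasurableSpace (List ℕ → ℕ) := offspringSigma (Set.Iio (n + 1))
    have h1 : Measurable fun ξ => occupation (genSize ξ) w (n + 1) :=
      ih.mono (offspringSigma_mono (Set.Iio_subset_Iio n.le_succ)) le_rfl
    have h2 : Measurable fun ξ =>
        if 1 ≤ genSize ξ (n + 1) ∧ genSize ξ (n + 1) ≤ w then 1 else 0 :=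
      (measurable_of_countable fun z : ℕ => if 1 ≤ z ∧ z ≤ w then 1 else 0).comp
        (measurable_genSize_offspringSigma (n + 1))
    simp only [occupation_succ _ w (n + 1)]
    exact h1.add h2

theorem measurable_occupation (w n : ℕ) :
    Measurable fun ξ => occupation (genSize ξ) w n := by
  rcases n with _ | n
  · simp [occupation]
  · exact (measurable_occupation_succ_offspringSigma w n).mono (offspringSigma_le _) le_rfl

/-! ### The Lyapunov function -/

/-- The weight of the scale `2 ^ j` in the Lyapunov function. -/
noncomputable def scaleWeight (δ : ℝ) (j : ℕ) : ℝ := 32 * 2 ^ j / δ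

/-- The rate of the scale `2 ^ j` in the Lyapunov function. -/
noncomputable def scaleRate (j : ℕ) : ℝ := (1 / 2) ^ (j + 1)

/-- A bounded function which decreases by one in expectation at each step that a critical or
subcritical Galton-Watson process makes from a state in `[1, 2 ^ k]`. -/
noncomputable def lyapunov (δ : ℝ) (k z : ℕ) : ℝ :=
  ∑ j ∈ Finset.range (k + 1), scaleWeight δ j * (1 - (1 - scaleRate j) ^ z)

/-- An upper bound for the expectation of `lyapunov δ k` after one step from the state `z`. -/
noncomputable def lyapunovStep (δ : ℝ) (k z : ℕ) : ℝ :=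
  ∑ j ∈ Finset.range (k + 1),
    scaleWeight δ j * (1 - (1 - scaleRate j + δ * (scaleRate j ^ 2 / 2)) ^ z)

theorem scaleRate_pos (j : ℕ) : 0 < scaleRate j := by
  unfold scaleRate
  positivity

theorem scaleRate_le_one (j : ℕ) : scaleRate j ≤ 1 :=
  pow_le_one₀ (by norm_num) (by norm_num)

theorem scaleWeight_nonneg {δ : ℝ} (hδ : 0 < δ) (j : ℕ) : 0 ≤ scaleWeight δ j := by
  unfold scaleWeight
  positivity

theorem lyapunov_nonneg {δ : ℝ} (hδ : 0 < δ) (k z : ℕ) : 0 ≤ lyapunov δ k z := by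
  refine Finset.sum_nonneg fun j _ => mul_nonneg (scaleWeight_nonneg hδ j) (sub_nonneg.2 ?_)
  exact pow_le_one₀ (sub_nonneg.2 (scaleRate_le_one j)) (by linarith [scaleRate_pos j])

theorem lyapunov_le {δ : ℝ} (hδ : 0 < δ) (k z : ℕ) : lyapunov δ k z ≤ 64 * 2 ^ k / δ := by
  have h1 : lyapunov δ k z ≤ ∑ j ∈ Finset.range (k + 1), scaleWeight δ j := by
    refine Finset.sum_le_sum fun j _ => mul_le_of_le_one_right (scaleWeight_nonneg hδ j) ?_
    linarith [pow_nonneg (sub_nonneg.2 (scaleRate_le_one j)) z]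
  refine h1.trans ?_
  simp only [scaleWeight]
  rw [← Finset.sum_div, ← Finset.mul_sum, geom_sum_eq (by norm_num)]
  refine div_le_div_of_nonneg_right ?_ hδ.le
  rw [pow_succ]
  norm_num
  linarith

/-- Every scale contributes 16/δ. The linear growth in k, against the bound of order 2^k, is what
makes the later sum over k converge. -/
theorem lyapunov_one (δ : ℝ) (k : ℕ) : lyapunov δ k 1 = 16 * (k + 1) / δ := by
  have h : ∀ j, scaleWeight δ j * (1 - (1 - scaleRate j) ^ 1) = 16 / δ := by
    intro j
    have h2 : (2 : ℝ) ^ j * (1 / 2) ^ j = 1 := by rw [← mul_pow]; norm_num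
    rw [scaleWeight, scaleRate, pow_one, sub_sub_cancel, pow_succ]
    linear_combination (16 / δ) * h2
  simp only [lyapunov, h, Finset.sum_const, Finset.card_range, nsmul_eq_mul]
  push_cast
  ring

/-- The tangent bound at 1 - s, with Bernoulli's inequality (1-s)^(z-1) ≥ 1 - zs ≥ 1/2 for the
slope. -/
theorem one_sub_pow_add_le {δ s : ℝ} (hδ : 0 ≤ δ) (h0 : 0 ≤ s) (h1 : s ≤ 1) {z : ℕ}
    (hz : z * s ≤ 1 / 2) :
    (1 - s) ^ z + z * δ * s ^ 2 / 4 ≤ (1 - s + δ * (s ^ 2 / 2)) ^ z := by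
  have hle : 1 - s ≤ 1 - s + δ * (s ^ 2 / 2) := by
    have : 0 ≤ δ * (s ^ 2 / 2) := by positivity
    linarith
  have h2 := mul_pow_pred_mul_sub_le (sub_nonneg.2 h1) hle z
  have h3 : 1 / 2 ≤ (1 - s) ^ (z - 1) := by
    have h4 := one_add_mul_le_pow (a := -s) (by linarith) (z - 1)
    have h5 : ((z - 1 : ℕ) : ℝ) * s ≤ z * s := by
      gcongr
      exact Nat.sub_le _ _
    rw [← sub_eq_add_neg] at h4
    linarith
  have h6 : (z : ℝ) * (1 / 2) * (δ * (s ^ 2 / 2)) ≤ z * (1 - s) ^ (z - 1) * (δ * (s ^ 2 / 2)) := by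
    gcongr
  rw [add_sub_cancel_left] at h2
  linarith

theorem pow_clog_two_le {z : ℕ} (hz : 1 ≤ z) : 2 ^ Nat.clog 2 z ≤ 2 * z := by
  rcases hz.eq_or_lt with h | h
  · simp [← h]
  · have h1 := Nat.pow_pred_clog_lt_self one_lt_two h
    have h2 : 2 ^ (Nat.clog 2 z).pred * 2 = 2 ^ Nat.clog 2 z := by
      rw [← pow_succ, ← Nat.succ_eq_add_one,
        Nat.succ_pred_eq_of_pos (Nat.clog_pos one_lt_two h)]
    omega

/-- Every scale contributes a nonnegative decrease, and for z in [1, 2^k] the scale with z ≤ 2^j ≤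
2z alone contributes at least 1. -/
theorem lyapunovStep_add_le {δ : ℝ} (hδ : 0 < δ) (k z : ℕ) :
    lyapunovStep δ k z + (if 1 ≤ z ∧ z ≤ 2 ^ k then 1 else 0) ≤ lyapunov δ k z := by
  have hterm : ∀ j, 0 ≤ scaleWeight δ j * ((1 - scaleRate j + δ * (scaleRate j ^ 2 / 2)) ^ z
      - (1 - scaleRate j) ^ z) := by
    intro j
    refine mul_nonneg (scaleWeight_nonneg hδ j) (sub_nonneg.2 ?_)
    have := sub_nonneg.2 (scaleRate_le_one j)
    have h2 : 0 ≤ δ * (scaleRate j ^ 2 / 2) := by positivity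
    gcongr
    linarith
  have hsum : lyapunov δ k z - lyapunovStep δ k z = ∑ j ∈ Finset.range (k + 1), scaleWeight δ j
      * ((1 - scaleRate j + δ * (scaleRate j ^ 2 / 2)) ^ z - (1 - scaleRate j) ^ z) := by
    rw [lyapunov, lyapunovStep, ← Finset.sum_sub_distrib]
    exact Finset.sum_congr rfl fun j _ => by ring
  suffices h : (if 1 ≤ z ∧ z ≤ 2 ^ k then (1 : ℝ) else 0) ≤ ∑ j ∈ Finset.range (k + 1),
      scaleWeight δ j
      * ((1 - scaleRate j + δ * (scaleRate j ^ 2 / 2)) ^ z - (1 - scaleRate j) ^ z) by linarith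
  split_ifs with hz
  · have hj : Nat.clog 2 z ≤ k := Nat.clog_le_of_le_pow hz.2
    refine le_trans ?_ (Finset.single_le_sum (fun j _ => hterm j)
      (Finset.mem_range.2 (Nat.lt_succ_of_le hj)))
    set j := Nat.clog 2 z
    have hz1 : (z : ℝ) ≤ 2 ^ j := by exact_mod_cast Nat.le_pow_clog one_lt_two z
    have hz2 : (2 : ℝ) ^ j ≤ 2 * z := by exact_mod_cast pow_clog_two_le hz.1
    have hs : scaleRate j * (2 * 2 ^ j) = 1 := by
      rw [scaleRate, mul_comm (2 : ℝ), ← pow_succ, ← mul_pow]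
      norm_num
    have hzs : z * scaleRate j ≤ 1 / 2 := by nlinarith [scaleRate_pos j]
    have h1 := one_sub_pow_add_le hδ.le (scaleRate_pos j).le (scaleRate_le_one j) hzs
    -- The weight 32·2^j/δ is chosen to cancel δ and one factor of the rate; the rate is at least
    -- 1/(4z).
    have h2 : scaleWeight δ j * (z * δ * scaleRate j ^ 2 / 4) = 4 * z * scaleRate j := by
      have : scaleWeight δ j * δ = 32 * 2 ^ j := by
        rw [scaleWeight]
        field_simp
      linear_combination (z * scaleRate j ^ 2 / 4) * this + 4 * z * scaleRate j * hs
    have h3 : 1 ≤ 4 * z * scaleRate j := by nlinarith [scaleRate_pos j]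
    rw [← h2] at h3
    refine h3.trans (mul_le_mul_of_nonneg_left ?_ (scaleWeight_nonneg hδ j))
    linarith
  · exact Finset.sum_nonneg fun j _ => hterm j

/-! ### Expected decrease under the weight `q ^ genSize` -/

theorem integrable_mul_comp_genSize {X : (List ℕ → ℕ) → ℝ} (hX : Measurable X) {b : ℝ}
    (hb : ∀ ξ, |X ξ| ≤ b) {g : ℕ → ℝ} {c : ℝ} (hc : ∀ z, |g z| ≤ c) (m : ℕ) :
    Integrable (fun ξ => X ξ * g (genSize ξ m)) (offspringLaw μ) := by
  refine Integrable.of_bound (C := b * c) (hX.mul ((measurable_of_countable g).comp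
    (measurable_genSize m))).aestronglyMeasurable (Filter.Eventually.of_forall fun ξ => ?_)
  rw [norm_mul]
  exact mul_le_mul (hb ξ) (hc _) (norm_nonneg _) ((abs_nonneg _).trans (hb ξ))

theorem abs_pow_le_one {a : ℝ} (h0 : 0 ≤ a) (h1 : a ≤ 1) (z : ℕ) : |a ^ z| ≤ 1 := by
  rw [abs_of_nonneg (pow_nonneg h0 z)]
  exact pow_le_one₀ h0 h1

/-- As q is a fixed point, the branching property makes `q ^ genSize ξ n` a martingale. -/
theorem integral_pow_genSize {q : ℝ} (h0 : 0 ≤ q) (h1 : q ≤ 1) (hq : pgf μ q = q) (n : ℕ) :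
    ∫ ξ, q ^ genSize ξ n ∂offspringLaw μ = q := by
  induction n with
  | zero => simp [genSize_zero]
  | succ n ih =>
    have h := integral_mul_pow_genSize_succ (μ := μ) (n := n) (X := fun _ => 1) measurable_const
      (fun _ => zero_le_one) h0 h1
    simpa only [one_mul, hq, ih] using h

/-- The weighted Lyapunov function is a combination of powers of q and of q(1-s). The branching
property replaces these bases by f(q) = q and by f(q(1-s)), which the quadratic gap bounds from
below. -/
theorem integral_lyapunov_genSize_succ_le {q : ℝ} (h0 : 0 ≤ q) (h1 : q ≤ 1) (hq : pgf μ q = q)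
    (hq2 : ∀ s : ℝ, 0 ≤ s → s ≤ 1 →
      q * (1 - s + (1 - μ.real {1}) * (s ^ 2 / 2)) ≤ pgf μ (q * (1 - s)))
    (hμ : 0 < 1 - μ.real {1}) (k n : ℕ) {X : (List ℕ → ℕ) → ℝ}
    (hX : Measurable[offspringSigma (Set.Iio n)] X) (hX0 : ∀ ξ, 0 ≤ X ξ) {b : ℝ}
    (hb : ∀ ξ, X ξ ≤ b) :
    ∫ ξ, X ξ * (lyapunov (1 - μ.real {1}) k (genSize ξ (n + 1)) * q ^ genSize ξ (n + 1))
        ∂offspringLaw μ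
      ≤ ∫ ξ, X ξ * (lyapunovStep (1 - μ.real {1}) k (genSize ξ n) * q ^ genSize ξ n)
        ∂offspringLaw μ := by
  set δ := 1 - μ.real {1}
  have hδ1 : δ ≤ 1 := sub_le_self _ measureReal_nonneg
  have hXm : Measurable X := hX.mono (offspringSigma_le _) le_rfl
  have hXb : ∀ ξ, |X ξ| ≤ b := fun ξ => (abs_of_nonneg (hX0 ξ)).trans_le (hb ξ)
  have hint : ∀ {a : ℝ}, 0 ≤ a → a ≤ 1 → ∀ m,
      Integrable (fun ξ => X ξ * a ^ genSize ξ m) (offspringLaw μ) := fun h0 h1 m =>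
    integrable_mul_comp_genSize hXm hXb (abs_pow_le_one h0 h1) m
  have hexp : ∀ (a : ℕ → ℝ) (m : ℕ), (∀ j, 0 ≤ a j) → (∀ j, a j ≤ 1) →
      ∫ ξ, X ξ * ((∑ j ∈ Finset.range (k + 1), scaleWeight δ j * (1 - a j ^ genSize ξ m))
          * q ^ genSize ξ m) ∂offspringLaw μ
        = ∑ j ∈ Finset.range (k + 1), scaleWeight δ j
          * (∫ ξ, X ξ * q ^ genSize ξ m ∂offspringLaw μ
            - ∫ ξ, X ξ * (q * a j) ^ genSize ξ m ∂offspringLaw μ) := by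
    intro a m ha0 ha1
    have hqa := fun j => hint (mul_nonneg h0 (ha0 j)) (mul_le_one₀ h1 (ha0 j) (ha1 j)) m
    simp only [← integral_sub (hint h0 h1 m) (hqa _), ← integral_const_mul]
    have hi : ∀ j, Integrable (fun ξ => scaleWeight δ j
        * (X ξ * q ^ genSize ξ m - X ξ * (q * a j) ^ genSize ξ m)) (offspringLaw μ) := fun j =>
      ((hint h0 h1 m).sub (hqa j)).const_mul _
    rw [← integral_finsetSum _ fun j _ => hi j]
    refine integral_congr_ae (Filter.Eventually.of_forall fun ξ => ?_)
    simp only [Finset.sum_mul, Finset.mul_sum, mul_pow]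
    exact Finset.sum_congr rfl fun j _ => by ring
  have hs0 := fun j => sub_nonneg.2 (scaleRate_le_one j)
  have hd0 : ∀ j, 0 ≤ 1 - scaleRate j + δ * (scaleRate j ^ 2 / 2) := fun j => by
    have := hs0 j
    positivity
  have hd1 : ∀ j, 1 - scaleRate j + δ * (scaleRate j ^ 2 / 2) ≤ 1 := fun j => by
    nlinarith [scaleRate_pos j, scaleRate_le_one j, sq_nonneg (scaleRate j)]
  have hs1 : ∀ j, 1 - scaleRate j ≤ 1 := fun j => by linarith [scaleRate_pos j]
  simp only [lyapunov, lyapunovStep]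
  rw [hexp _ _ hs0 hs1, hexp _ _ hd0 hd1]
  refine Finset.sum_le_sum fun j _ => mul_le_mul_of_nonneg_left ?_ (scaleWeight_nonneg hμ j)
  rw [integral_mul_pow_genSize_succ hX hX0 h0 h1,
    integral_mul_pow_genSize_succ hX hX0 (mul_nonneg h0 (hs0 j))
      (mul_le_one₀ h1 (hs0 j) (hs1 j)), hq]
  refine sub_le_sub_left ?_ _
  have hle := hq2 _ (scaleRate_pos j).le (scaleRate_le_one j)
  have hp1 : pgf μ (q * (1 - scaleRate j)) ≤ 1 := by
    have := integral_mono (μ := μ) (integrable_pow (mul_nonneg h0 (hs0 j))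
      (mul_le_one₀ h1 (hs0 j) (hs1 j))) (integrable_const (1 : ℝ))
      fun i => pow_le_one₀ (mul_nonneg h0 (hs0 j)) (mul_le_one₀ h1 (hs0 j) (hs1 j))
    simpa [pgf] using this
  refine integral_mono (hint (mul_nonneg h0 (hd0 j)) (mul_le_one₀ h1 (hd0 j) (hd1 j)) n)
    (hint (pgf_nonneg (mul_nonneg h0 (hs0 j))) hp1 n) fun ξ => ?_
  have := hX0 ξ
  have := mul_nonneg h0 (hd0 j)
  dsimp only
  gcongr

/-! ### Exponential moments of the occupation time -/

/-- The rate of the exponential moments of the occupation of `[1, 2 ^ k]`. -/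
noncomputable def occupationRate (δ : ℝ) (k : ℕ) : ℝ := δ / (64 * 2 ^ k)

theorem occupationRate_pos {δ : ℝ} (hδ : 0 < δ) (k : ℕ) : 0 < occupationRate δ k := by
  unfold occupationRate
  positivity

theorem occupationRate_mul_lyapunov_le {δ : ℝ} (hδ : 0 < δ) (k z : ℕ) :
    occupationRate δ k * lyapunov δ k z ≤ 1 := by
  refine (mul_le_mul_of_nonneg_left (lyapunov_le hδ k z) (occupationRate_pos hδ k).le).trans_eq ?_
  rw [occupationRate]
  field_simp

/-- The integral does not increase with `n`: a step from [1, 2^k] lowers ηV by at least η in the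
mean, which pays for the new factor 1 + η/2 because ηV ≤ 1. -/
theorem integral_occupation_le {q : ℝ} (h0 : 0 ≤ q) (h1 : q ≤ 1) (hq : pgf μ q = q)
    (hq2 : ∀ s : ℝ, 0 ≤ s → s ≤ 1 →
      q * (1 - s + (1 - μ.real {1}) * (s ^ 2 / 2)) ≤ pgf μ (q * (1 - s)))
    (hμ : 0 < 1 - μ.real {1}) (k n : ℕ) :
    ∫ ξ, (1 + occupationRate (1 - μ.real {1}) k / 2) ^ occupation (genSize ξ) (2 ^ k) n
        * ((1 + occupationRate (1 - μ.real {1}) k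
          * lyapunov (1 - μ.real {1}) k (genSize ξ n)) * q ^ genSize ξ n) ∂offspringLaw μ
      ≤ q * (1 + occupationRate (1 - μ.real {1}) k * lyapunov (1 - μ.real {1}) k 1) := by
  set δ := 1 - μ.real {1}
  set η := occupationRate δ k
  have hη : 0 < η := occupationRate_pos hμ k
  induction n with
  | zero => simp [genSize_zero, occupation, mul_comm]
  | succ n ih =>
    refine le_trans ?_ ih
    set X : (List ℕ → ℕ) → ℝ := fun ξ => (1 + η / 2) ^ occupation (genSize ξ) (2 ^ k) (n + 1)
    have hX0 : ∀ ξ, 0 ≤ X ξ := fun ξ => by positivity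
    have hbound : ∀ m ξ, (1 + η / 2) ^ occupation (genSize ξ) (2 ^ k) m ≤ (1 + η / 2) ^ m :=
      fun m ξ => pow_le_pow_right₀ (by linarith) (occupation_le _ _ _)
    have hXb : ∀ ξ, X ξ ≤ (1 + η / 2) ^ (n + 1) := hbound (n + 1)
    have hX : Measurable[offspringSigma (Set.Iio n)] X :=
      (measurable_of_countable fun i : ℕ => (1 + η / 2) ^ i).comp
        (measurable_occupation_succ_offspringSigma (2 ^ k) n)
    have hXm : Measurable X := hX.mono (offspringSigma_le _) le_rfl
    have hXa : ∀ ξ, |X ξ| ≤ (1 + η / 2) ^ (n + 1) := fun ξ =>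
      (abs_of_nonneg (hX0 ξ)).trans_le (hXb ξ)
    have hV : ∀ z, |lyapunov δ k z * q ^ z| ≤ 64 * 2 ^ k / δ := fun z => by
      rw [abs_of_nonneg (mul_nonneg (lyapunov_nonneg hμ k z) (pow_nonneg h0 z))]
      exact (mul_le_of_le_one_right (lyapunov_nonneg hμ k z) (pow_le_one₀ h0 h1)).trans
        (lyapunov_le hμ k z)
    have hΦ : ∀ z, |(1 + η * lyapunov δ k z) * q ^ z| ≤ 2 := fun z => by
      have hn := lyapunov_nonneg hμ k z
      rw [abs_of_nonneg (by positivity)]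
      refine (mul_le_of_le_one_right (by positivity) (pow_le_one₀ h0 h1)).trans ?_
      linarith [occupationRate_mul_lyapunov_le hμ k z]
    have hU : ∀ z, |lyapunovStep δ k z * q ^ z| ≤ 64 * 2 ^ k / δ := fun z => by
      have hn : 0 ≤ lyapunovStep δ k z := by
        refine Finset.sum_nonneg fun j _ => mul_nonneg (scaleWeight_nonneg hμ j) (sub_nonneg.2 ?_)
        have hδ1 : δ ≤ 1 := sub_le_self _ measureReal_nonneg
        have hs := sub_nonneg.2 (scaleRate_le_one j)
        refine pow_le_one₀ (by positivity) ?_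
        nlinarith [scaleRate_pos j, scaleRate_le_one j, sq_nonneg (scaleRate j)]
      have hle := lyapunovStep_add_le hμ k z
      have hi : (0 : ℝ) ≤ if 1 ≤ z ∧ z ≤ 2 ^ k then 1 else 0 := by split_ifs <;> norm_num
      rw [abs_of_nonneg (mul_nonneg hn (pow_nonneg h0 z))]
      refine (mul_le_of_le_one_right hn (pow_le_one₀ h0 h1)).trans ?_
      linarith [lyapunov_le hμ k z]
    have hi1 := fun m => integrable_mul_comp_genSize (μ := μ) hXm hXa (abs_pow_le_one h0 h1) m
    have hi2 := integrable_mul_comp_genSize (μ := μ) hXm hXa hV (n + 1)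
    have hi3 := integrable_mul_comp_genSize (μ := μ) hXm hXa hU n
    have hi4 : Integrable (fun ξ => (1 + η / 2) ^ occupation (genSize ξ) (2 ^ k) n
        * ((1 + η * lyapunov δ k (genSize ξ n)) * q ^ genSize ξ n)) (offspringLaw μ) :=
      integrable_mul_comp_genSize ((measurable_of_countable fun i : ℕ => (1 + η / 2) ^ i).comp
        (measurable_occupation (2 ^ k) n)) (b := (1 + η / 2) ^ n)
        (fun ξ => (abs_of_nonneg (by dsimp only [Function.comp]; positivity)).trans_le
          (hbound n ξ)) hΦ n
    have hstep := integral_lyapunov_genSize_succ_le h0 h1 hq hq2 hμ k n hX hX0 hXb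
    have hpow := integral_mul_pow_genSize_succ (μ := μ) hX hX0 h0 h1
    rw [hq] at hpow
    calc ∫ ξ, X ξ * ((1 + η * lyapunov δ k (genSize ξ (n + 1))) * q ^ genSize ξ (n + 1))
          ∂offspringLaw μ
        = ∫ ξ, X ξ * q ^ genSize ξ (n + 1) ∂offspringLaw μ
          + η * ∫ ξ, X ξ * (lyapunov δ k (genSize ξ (n + 1)) * q ^ genSize ξ (n + 1))
            ∂offspringLaw μ := by
          rw [← integral_const_mul, ← integral_add (hi1 (n + 1)) (hi2.const_mul η)]
          exact integral_congr_ae (Filter.Eventually.of_forall fun ξ => by dsimp only; ring)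
      _ ≤ ∫ ξ, X ξ * q ^ genSize ξ n ∂offspringLaw μ
          + η * ∫ ξ, X ξ * (lyapunovStep δ k (genSize ξ n) * q ^ genSize ξ n)
            ∂offspringLaw μ := by
          rw [hpow]
          gcongr
      _ = ∫ ξ, X ξ * q ^ genSize ξ n
          + η * (X ξ * (lyapunovStep δ k (genSize ξ n) * q ^ genSize ξ n)) ∂offspringLaw μ := by
          rw [← integral_const_mul, ← integral_add (hi1 n) (hi3.const_mul η)]
      _ ≤ _ := by
          refine integral_mono ((hi1 n).add (hi3.const_mul η)) hi4 fun ξ => ?_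
          have hle := lyapunovStep_add_le hμ k (genSize ξ n)
          have hη1 := occupationRate_mul_lyapunov_le hμ k (genSize ξ n)
          have hqz := pow_nonneg h0 (genSize ξ n)
          have hY : 0 ≤ (1 + η / 2) ^ occupation (genSize ξ) (2 ^ k) n := by positivity
          simp only [X, occupation_succ]
          split_ifs at hle ⊢ with hz
          · have hle2 := mul_le_mul_of_nonneg_left hle hη.le
            -- With U the one-step bound, ηU ≤ 1 makes the extra term (η/2)(1 + ηU) at most η, and
            -- ηU + η ≤ ηV.
            have hfac : (1 + η / 2) * (1 + η * lyapunovStep δ k (genSize ξ n))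
                ≤ 1 + η * lyapunov δ k (genSize ξ n) := by
              change η * lyapunov δ k (genSize ξ n) ≤ 1 at hη1
              nlinarith
            have := mul_le_mul_of_nonneg_left hfac (mul_nonneg hY hqz)
            rw [pow_succ]
            linarith
          · have hle2 := mul_le_mul_of_nonneg_left hle hη.le
            have := mul_le_mul_of_nonneg_left hle2 (mul_nonneg hY hqz)
            rw [add_zero]
            linarith

/-- A Chernoff bound for the occupation of `[1, 2 ^ k]`. -/
theorem measureReal_mul_le {q : ℝ} (h0 : 0 ≤ q) (h1 : q ≤ 1) (hq : pgf μ q = q)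
    (hq2 : ∀ s : ℝ, 0 ≤ s → s ≤ 1 →
      q * (1 - s + (1 - μ.real {1}) * (s ^ 2 / 2)) ≤ pgf μ (q * (1 - s)))
    (hμ : 0 < 1 - μ.real {1}) (k n m : ℕ) {A : Set (List ℕ → ℕ)} (hA : MeasurableSet A) {c : ℝ}
    (hc : 0 ≤ c) (hAm : ∀ ξ ∈ A, m ≤ occupation (genSize ξ) (2 ^ k) n)
    (hAc : ∀ ξ ∈ A, c ≤ q ^ genSize ξ n) :
    (offspringLaw μ).real A
        * (((1 + occupationRate (1 - μ.real {1}) k / 2) ^ m - 1) * c)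
      ≤ (k + 1) / (4 * 2 ^ k) := by
  set δ := 1 - μ.real {1}
  set η := occupationRate δ k
  have hη : 0 < η := occupationRate_pos hμ k
  have hmain := integral_occupation_le h0 h1 hq hq2 hμ k n
  have hV1 : η * lyapunov δ k 1 = (k + 1) / (4 * 2 ^ k) := by
    rw [lyapunov_one]
    simp only [η, occupationRate]
    field_simp
    norm_num
  have hYb : ∀ ξ, |(1 + η / 2) ^ occupation (genSize ξ) (2 ^ k) n| ≤ (1 + η / 2) ^ n := fun ξ => by
    rw [abs_of_nonneg (by positivity)]
    exact pow_le_pow_right₀ (by linarith) (occupation_le _ _ _)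
  have hΦ : ∀ z, |(1 + η * lyapunov δ k z) * q ^ z| ≤ 2 := fun z => by
    have hn := lyapunov_nonneg hμ k z
    rw [abs_of_nonneg (by positivity)]
    refine (mul_le_of_le_one_right (by positivity) (pow_le_one₀ h0 h1)).trans ?_
    linarith [occupationRate_mul_lyapunov_le hμ k z]
  have hi1 := integrable_mul_comp_genSize (μ := μ)
    ((measurable_of_countable fun i : ℕ => (1 + η / 2) ^ i).comp (measurable_occupation (2 ^ k) n))
    hYb hΦ n
  have hi2 : Integrable (fun ξ => q ^ genSize ξ n) (offspringLaw μ) := by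
    simpa using integrable_mul_comp_genSize (μ := μ) (X := fun _ => 1) (b := 1) measurable_const
      (by simp) (abs_pow_le_one h0 h1) n
  have hi3 : Integrable (A.indicator fun _ => ((1 + η / 2) ^ m - 1) * c) (offspringLaw μ) :=
    (integrable_const _).indicator hA
  -- Subtracting `q ^ genSize ξ n`, whose integral is q, leaves qηV(1) on the right instead of q(1 +
  -- ηV(1)).
  have h2 := integral_mono hi3 (hi1.sub hi2) fun ξ => ?_
  · simp only [Pi.sub_apply] at h2
    rw [integral_sub hi1 hi2, integral_pow_genSize h0 h1 hq, integral_indicator_const _ hA,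
      smul_eq_mul] at h2
    refine h2.trans ?_
    rw [← hV1]
    have h3 : 0 ≤ η * lyapunov δ k 1 := mul_nonneg hη.le (lyapunov_nonneg hμ k 1)
    have h4 := mul_le_of_le_one_left h3 h1
    change _ ≤ q * (1 + η * lyapunov δ k 1) at hmain
    simp only [Function.comp_apply]
    linarith
  · simp only [Pi.sub_apply, Function.comp_apply]
    have hn := lyapunov_nonneg hμ k (genSize ξ n)
    have hΦ1 : 1 ≤ 1 + η * lyapunov δ k (genSize ξ n) := by
      have : 0 ≤ η * lyapunov δ k (genSize ξ n) := by positivity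
      linarith
    have hqz := pow_nonneg h0 (genSize ξ n)
    have hY1 : 1 ≤ (1 + η / 2) ^ occupation (genSize ξ) (2 ^ k) n := one_le_pow₀ (by linarith)
    have hge : (1 + η / 2) ^ occupation (genSize ξ) (2 ^ k) n * q ^ genSize ξ n
        ≤ (1 + η / 2) ^ occupation (genSize ξ) (2 ^ k) n
          * ((1 + η * lyapunov δ k (genSize ξ n)) * q ^ genSize ξ n) := by
      gcongr
      exact le_mul_of_one_le_left hqz hΦ1
    by_cases hξ : ξ ∈ A
    · rw [Set.indicator_of_mem hξ]
      have hpow : (1 + η / 2) ^ m ≤ (1 + η / 2) ^ occupation (genSize ξ) (2 ^ k) n :=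
        pow_le_pow_right₀ (by linarith) (hAm ξ hξ)
      have := mul_le_mul (sub_le_sub_right hpow 1) (hAc ξ hξ) hc (by linarith)
      linarith
    · rw [Set.indicator_of_notMem hξ]
      nlinarith

/-! ### All dyadic levels simultaneously -/

theorem exp_half_le_one_add {u : ℝ} (h0 : 0 ≤ u) (h1 : u ≤ 1) : Real.exp (u / 2) ≤ 1 + u := by
  have h2 := Real.add_one_le_exp (-(u / 2))
  have h3 : Real.exp (u / 2) * Real.exp (-(u / 2)) = 1 := by
    rw [← Real.exp_add]
    simp
  have h4 := mul_le_mul_of_nonneg_left h2 (Real.exp_pos (u / 2)).le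
  rw [h3] at h4
  nlinarith [Real.exp_pos (u / 2)]

theorem occupation_mono (Z : ℕ → ℕ) (w : ℕ) : Monotone (occupation Z w) :=
  monotone_nat_of_le_succ fun n => by
    rw [occupation_succ]
    exact Nat.le_add_right _ _

/-- Since 512 = 8·64, mη ≥ 8x. Each factor is at least exp(η/4), so the power is at least e^{2x},
and e^{2x} - 1 ≥ e^x for x ≥ 1. -/
theorem exp_le_occupationRate_pow_sub_one {δ x : ℝ} (hδ : 0 < δ) (hδ1 : δ ≤ 1) (hx : 1 ≤ x)
    (k : ℕ) {m : ℕ} (hm : 512 * x * 2 ^ k / δ ≤ m) :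
    Real.exp x ≤ (1 + occupationRate δ k / 2) ^ m - 1 := by
  have hη := occupationRate_pos hδ k
  have hη1 : occupationRate δ k ≤ 1 := by
    rw [occupationRate, div_le_one (by positivity)]
    have : (1 : ℝ) ≤ 2 ^ k := one_le_pow₀ (by norm_num)
    linarith
  have h1 : Real.exp (2 * x) ≤ (1 + occupationRate δ k / 2) ^ m := by
    refine le_trans ?_ (pow_le_pow_left₀ (Real.exp_pos _).le
      (exp_half_le_one_add (u := occupationRate δ k / 2) (by positivity) (by linarith)) m)
    rw [← Real.exp_nat_mul, Real.exp_le_exp]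
    have h2 := mul_le_mul_of_nonneg_right hm hη.le
    have h3 : 512 * x * 2 ^ k / δ * occupationRate δ k = 8 * x := by
      rw [occupationRate]
      field_simp
      norm_num
    linarith
  have h4 : Real.exp (2 * x) = Real.exp x * Real.exp x := by rw [← Real.exp_add]; ring_nf
  nlinarith [Real.add_one_le_exp x]

theorem hasSum_succ_div_pow : HasSum (fun k : ℕ => ((k : ℝ) + 1) / (4 * 2 ^ k)) 1 := by
  have h1 := hasSum_coe_mul_geometric_of_norm_lt_one (r := (1 / 2 : ℝ)) (by norm_num)
  have h2 := (h1.add hasSum_geometric_two).mul_left (1 / 4)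
  have e1 : (fun k : ℕ => ((k : ℝ) + 1) / (4 * 2 ^ k))
      = fun k : ℕ => 1 / 4 * ((k : ℝ) * (1 / 2) ^ k + (1 / 2) ^ k) := by
    funext k
    rw [div_pow, one_pow]
    field_simp
  have e2 : (1 : ℝ) / 4 * (1 / 2 / (1 - 1 / 2) ^ 2 + 2) = 1 := by norm_num
  rw [e2] at h2
  rwa [e1]

/-- Simultaneously over all dyadic levels, the time that a Galton-Watson process spends below a
level before its extinction has exponential tails. -/
theorem measure_exists_occupation_le (hμ : 0 < 1 - μ.real {1}) {x : ℝ} (hx : 1 ≤ x) :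
    offspringLaw μ {ξ | ∃ k n : ℕ, genSize ξ n = 0 ∧
        512 * x * 2 ^ k / (1 - μ.real {1}) ≤ occupation (genSize ξ) (2 ^ k) n}
      ≤ ENNReal.ofReal (Real.exp (-x)) := by
  obtain ⟨q, h0, h1, hq, hq2⟩ := exists_fixedPoint μ
  set δ := 1 - μ.real {1}
  have hδ1 : δ ≤ 1 := sub_le_self _ measureReal_nonneg
  let B : ℕ → ℕ → Set (List ℕ → ℕ) := fun k n =>
    {ξ | genSize ξ n = 0 ∧ 512 * x * 2 ^ k / δ ≤ occupation (genSize ξ) (2 ^ k) n}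
  have hB : ∀ k n, offspringLaw μ (B k n)
      ≤ ENNReal.ofReal (Real.exp (-x)) * ENNReal.ofReal ((k + 1) / (4 * 2 ^ k)) := by
    intro k n
    have hmeas : MeasurableSet (B k n) := by
      refine MeasurableSet.inter (measurable_genSize n (measurableSet_singleton 0)) ?_
      exact measurable_occupation (2 ^ k) n
        (MeasurableSet.of_discrete (s := {i : ℕ | 512 * x * 2 ^ k / δ ≤ i}))
    have h := measureReal_mul_le h0 h1 hq hq2 hμ k n ⌈512 * x * 2 ^ k / δ⌉₊ hmeas
      zero_le_one (fun ξ hξ => Nat.ceil_le.2 hξ.2) (fun ξ hξ => by rw [hξ.1, pow_zero])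
    have h2 := exp_le_occupationRate_pow_sub_one hμ hδ1 hx k (Nat.le_ceil _)
    rw [mul_one] at h
    have h3 := (mul_le_mul_of_nonneg_left h2
      (measureReal_nonneg (μ := offspringLaw μ) (s := B k n))).trans h
    rw [← ENNReal.ofReal_mul (Real.exp_pos _).le, ← ofReal_measureReal]
    refine ENNReal.ofReal_le_ofReal ?_
    rw [Real.exp_neg, inv_mul_eq_div, le_div_iff₀ (Real.exp_pos x)]
    exact h3
  -- Extinction persists and occupation only grows, so the union over `n` costs nothing; only the
  -- union over `k` is summed.
  have hmono : ∀ k, Monotone (B k) := fun k => monotone_nat_of_le_succ fun n ξ hξ =>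
    ⟨genSize_succ_eq_zero hξ.1,
      hξ.2.trans (Nat.cast_le.2 (occupation_mono _ _ n.le_succ))⟩
  have hU : {ξ | ∃ k n : ℕ, genSize ξ n = 0 ∧
      512 * x * 2 ^ k / δ ≤ occupation (genSize ξ) (2 ^ k) n} = ⋃ k, ⋃ n, B k n := by
    ext ξ
    simp [B]
  rw [hU]
  calc offspringLaw μ (⋃ k, ⋃ n, B k n)
      ≤ ∑' k, offspringLaw μ (⋃ n, B k n) := measure_iUnion_le _
    _ ≤ ∑' k : ℕ, ENNReal.ofReal (Real.exp (-x)) * ENNReal.ofReal ((k + 1) / (4 * 2 ^ k)) := by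
        refine ENNReal.tsum_le_tsum fun k => ?_
        rw [(hmono k).measure_iUnion]
        exact iSup_le (hB k)
    _ = ENNReal.ofReal (Real.exp (-x)) := by
        rw [ENNReal.tsum_mul_left, ← ENNReal.ofReal_tsum_of_nonneg (fun k => by positivity)
          hasSum_succ_div_pow.summable, hasSum_succ_div_pow.tsum_eq, ENNReal.ofReal_one, mul_one]

/-! ### Survival with bounded width is a null event -/

theorem measurableSet_forall_genSize_mem (w : ℕ) :
    MeasurableSet {ξ | ∀ n, 1 ≤ genSize ξ n ∧ genSize ξ n ≤ w} := by
  have h : {ξ | ∀ n, 1 ≤ genSize ξ n ∧ genSize ξ n ≤ w}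
      = ⋂ n, (fun ξ => genSize ξ n) ⁻¹' {z | 1 ≤ z ∧ z ≤ w} := by
    ext ξ
    simp
  rw [h]
  exact MeasurableSet.iInter fun n => measurable_genSize n MeasurableSet.of_discrete

/-- Without childless nodes, 2^{-k} ≤ 1/4 except at k = 1, where 1/4 has to be added. -/
theorem pgf_half_le (h : pgf μ 0 = 0) : pgf μ (1 / 2) ≤ (1 + μ.real {1}) / 2 * (1 / 2) := by
  have hi0 := integrable_pow (μ := μ) (le_refl (0 : ℝ)) zero_le_one
  have hi1 : Integrable (({1} : Set ℕ).indicator (1 : ℕ → ℝ)) μ :=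
    (integrable_const 1).indicator (measurableSet_singleton 1)
  have hi2 : Integrable (fun k => 1 / 4 * ({1} : Set ℕ).indicator (1 : ℕ → ℝ) k + 0 ^ k) μ :=
    (hi1.const_mul _).add hi0
  have hle := integral_mono (μ := μ) (integrable_pow (r := 1 / 2) (by norm_num) (by norm_num))
    ((integrable_const (1 / 4 : ℝ)).add hi2) fun k => ?_
  · simp only [Pi.add_apply] at hle
    rw [integral_add (integrable_const _) hi2, integral_add (hi1.const_mul _) hi0,
      integral_const_mul, integral_indicator_one (measurableSet_singleton 1)] at hle
    change pgf μ (1 / 2) ≤ _ + (_ + pgf μ 0) at hle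
    simp only [integral_const, probReal_univ, smul_eq_mul, h] at hle
    linarith
  · rcases k with _ | _ | k
    · norm_num
    · norm_num
    · have h1 : (1 / 2 : ℝ) ^ k ≤ 1 := pow_le_one₀ (by norm_num) (by norm_num)
      have h2 : (1 / 2 : ℝ) ^ (k + 1 + 1) ≤ 1 / 4 := by
        rw [pow_succ, pow_succ]
        linarith
      simpa using h2

theorem integral_half_pow_genSize_le (h : pgf μ 0 = 0) (n : ℕ) :
    ∫ ξ, (1 / 2 : ℝ) ^ genSize ξ n ∂offspringLaw μ ≤ ((1 + μ.real {1}) / 2) ^ n := by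
  have hint : ∀ {a : ℝ}, 0 ≤ a → a ≤ 1 → ∀ m,
      Integrable (fun ξ => a ^ genSize ξ m) (offspringLaw μ) := fun h0 h1 m => by
    simpa using integrable_mul_comp_genSize (μ := μ) (X := fun _ => 1) (b := 1) measurable_const
      (by simp) (abs_pow_le_one h0 h1) m
  have hp0 : 0 ≤ μ.real {1} := measureReal_nonneg
  have hp1 : μ.real {1} ≤ 1 := measureReal_le_one
  induction n with
  | zero => norm_num [genSize_zero]
  | succ n ih =>
    have hb := integral_mul_pow_genSize_succ (μ := μ) (n := n) (X := fun _ => 1) measurable_const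
      (fun _ => zero_le_one) (r := 1 / 2) (by norm_num) (by norm_num)
    simp only [one_mul] at hb
    have hf0 := pgf_nonneg (μ := μ) (r := 1 / 2) (by norm_num)
    have hf := pgf_half_le h
    rw [hb]
    have hle := integral_mono (hint hf0 (by linarith) n)
      (((hint (a := 1 / 2) (by norm_num) (by norm_num) n).const_mul ((1 + μ.real {1}) / 2)).add
        (hint le_rfl zero_le_one n)) fun ξ => ?_
    · simp only [Pi.add_apply] at hle
      rw [integral_add ((hint (by norm_num) (by norm_num) n).const_mul _)
        (hint le_rfl zero_le_one n), integral_const_mul,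
        -- As 0^0 = 1, this integral is the probability of extinction by time `n`, here zero.
        integral_pow_genSize le_rfl zero_le_one h, add_zero] at hle
      refine hle.trans ?_
      rw [pow_succ']
      gcongr
    · simp only [Pi.add_apply]
      rcases Nat.eq_zero_or_pos (genSize ξ n) with hz | hz
      · rw [hz]
        simp only [pow_zero]
        linarith
      · rw [zero_pow hz.ne', add_zero]
        refine (pow_le_pow_left₀ hf0 hf _).trans ?_
        rw [mul_pow]
        gcongr
        exact pow_le_of_le_one (by linarith) (by linarith) hz.ne'

/-- A nontrivial Galton-Watson process almost surely does not stay positive and bounded. -/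
theorem measure_forall_genSize_mem (hμ : 0 < 1 - μ.real {1}) (w : ℕ) :
    offspringLaw μ {ξ | ∀ n, 1 ≤ genSize ξ n ∧ genSize ξ n ≤ w} = 0 := by
  set A := {ξ | ∀ n, 1 ≤ genSize ξ n ∧ genSize ξ n ≤ w}
  have hA : MeasurableSet A := measurableSet_forall_genSize_mem w
  by_contra hne
  have hpos : 0 < (offspringLaw μ).real A :=
    measureReal_nonneg.lt_of_ne fun h => hne ((measureReal_eq_zero_iff).1 h.symm)
  obtain ⟨q, h0, h1, hq, hq2⟩ := exists_fixedPoint μ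
  rcases h0.eq_or_lt with rfl | hq0
  -- If q = 0, the expectation of 2^{-Z_n} decays geometrically, whereas on `A` the integrand is at
  -- least 2^{-w}.
  · have hle : ∀ n, (offspringLaw μ).real A * (1 / 2) ^ w ≤ ((1 + μ.real {1}) / 2) ^ n := by
      intro n
      refine le_trans ?_ (integral_half_pow_genSize_le hq n)
      rw [← smul_eq_mul, ← integral_indicator_const _ hA]
      refine integral_mono ((integrable_const _).indicator hA) ?_ fun ξ => ?_
      · simpa using integrable_mul_comp_genSize (μ := μ) (X := fun _ => 1) (b := 1)
          measurable_const (by simp) (abs_pow_le_one (a := 1 / 2) (by norm_num) (by norm_num)) n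
      · by_cases hξ : ξ ∈ A
        · rw [Set.indicator_of_mem hξ]
          exact pow_le_pow_of_le_one (by norm_num) (by norm_num) (hξ n).2
        · rw [Set.indicator_of_notMem hξ]
          positivity
    have hp0 : 0 ≤ μ.real {1} := measureReal_nonneg
    obtain ⟨n, hn⟩ := exists_pow_lt_of_lt_one
      (mul_pos hpos (show (0 : ℝ) < (1 / 2) ^ w by positivity))
      (show (1 + μ.real {1}) / 2 < 1 by linarith)
    exact absurd (hle n) (not_le.2 hn)
  -- If q > 0, the weight is at least q^w on `A`, where every time is counted since w ≤ 2^w. By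
  -- Bernoulli's inequality the Chernoff factor grows at least linearly in n, while the bound does
  -- not depend on n.
  · have hη := occupationRate_pos hμ w
    have hle : ∀ n : ℕ, n * ((offspringLaw μ).real A * (occupationRate (1 - μ.real {1}) w / 2)
        * q ^ w) ≤ (w + 1) / (4 * 2 ^ w) := by
      intro n
      have h := measureReal_mul_le h0 h1 hq hq2 hμ w n n hA (pow_nonneg h0 w)
        (fun ξ hξ => ?_) fun ξ hξ => pow_le_pow_of_le_one h0 h1 (hξ n).2
      · refine le_trans ?_ h
        have hb := one_add_mul_le_pow (a := occupationRate (1 - μ.real {1}) w / 2) (by linarith) n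
        have hb2 := mul_le_mul_of_nonneg_left (sub_le_sub_right hb 1)
          (mul_nonneg hpos.le (pow_nonneg h0 w))
        linarith
      · rw [occupation, Finset.filter_true_of_mem, Finset.card_range]
        exact fun i _ => ⟨(hξ i).1, (hξ i).2.trans Nat.lt_two_pow_self.le⟩
    have hc : 0 < (offspringLaw μ).real A * (occupationRate (1 - μ.real {1}) w / 2) * q ^ w := by
      positivity
    obtain ⟨n, hn⟩ := exists_nat_gt ((w + 1) / (4 * 2 ^ w)
      / ((offspringLaw μ).real A * (occupationRate (1 - μ.real {1}) w / 2) * q ^ w))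
    rw [div_lt_iff₀ hc] at hn
    exact absurd (hle n) (not_le.2 hn)

/-! ### Measurability of width, height and volume -/

theorem measurable_encard_generation (n : ℕ) :
    Measurable fun T : PlaneTree => ((T.generation n).encard : ℝ≥0∞) := by
  have hnodes : Measurable PlaneTree.nodes := comap_measurable _
  have hmem : ∀ u : List ℕ, MeasurableSet {T : PlaneTree | u ∈ T.nodes} := fun u =>
    measurableSet_setOfPred.2 (measurable_set_iff.1 hnodes u)
  have h : (fun T : PlaneTree => ((T.generation n).encard : ℝ≥0∞))
      = fun T => ∑' u : List ℕ, {T : PlaneTree | u ∈ T.generation n}.indicator 1 T := by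
    funext T
    rw [← ENNReal.tsum_set_one, tsum_subtype (T.generation n) fun _ => (1 : ℝ≥0∞)]
    rfl
  rw [h]
  refine Measurable.tsum fun u => measurable_one.indicator ?_
  by_cases hu : u.length = n
  · simpa [PlaneTree.generation, hu] using hmem u
  · simp [PlaneTree.generation, hu]

theorem measurable_width : Measurable fun T : PlaneTree => (T.width : ℝ≥0∞) := by
  simp only [PlaneTree.width, ENat.toENNReal_iSup]
  exact Measurable.iSup measurable_encard_generation

theorem measurable_height : Measurable fun T : PlaneTree => (T.height : ℝ≥0∞) := by
  have h : (fun T : PlaneTree => (T.height : ℝ≥0∞))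
      = fun T => ⨆ n : ℕ, {T : PlaneTree | (T.generation n).Nonempty}.indicator
        (fun _ => (n : ℝ≥0∞)) T := by
    funext T
    simp only [PlaneTree.height, ENat.toENNReal_iSup]
    refine iSup_congr fun n => ?_
    by_cases hn : (T.generation n).Nonempty
    · simp [hn]
    · simp [hn]
  rw [h]
  refine Measurable.iSup fun n => measurable_const.indicator ?_
  have h2 : {T : PlaneTree | (T.generation n).Nonempty}
      = {T | ((T.generation n).encard : ℝ≥0∞) ≠ 0} := by
    ext T
    simp [Set.nonempty_iff_ne_empty]
  rw [h2]
  exact (measurable_encard_generation n (measurableSet_singleton 0)).compl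

theorem measurable_volume : Measurable fun T : PlaneTree => (T.volume : ℝ≥0∞) := by
  have h : (fun T : PlaneTree => (T.volume : ℝ≥0∞))
      = fun T => ∑' u : List ℕ, {T : PlaneTree | u ∈ T.nodes}.indicator 1 T := by
    funext T
    rw [PlaneTree.volume, ← ENNReal.tsum_set_one, tsum_subtype T.nodes fun _ => (1 : ℝ≥0∞)]
    rfl
  have hnodes : Measurable PlaneTree.nodes := comap_measurable _
  rw [h]
  exact Measurable.tsum fun u => measurable_one.indicator
    (measurableSet_setOfPred.2 (measurable_set_iff.1 hnodes u))

/-! ### From tall trees to long occupation times -/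

theorem genSize_le_width (ξ : List ℕ → ℕ) (n : ℕ) :
    (genSize ξ n : ℕ∞) ≤ (PlaneTree.ofOffspring ξ).width := by
  rw [← encard_generation]
  exact le_iSup (fun n => ((PlaneTree.ofOffspring ξ).generation n).encard) n

theorem genSize_eq_zero_of_le {ξ : List ℕ → ℕ} {m n : ℕ} (hmn : m ≤ n) (h : genSize ξ m = 0) :
    genSize ξ n = 0 := by
  induction hmn with
  | refl => exact h
  | step _ ih => exact genSize_succ_eq_zero ih

theorem height_le {ξ : List ℕ → ℕ} {h : ℕ} (hh : genSize ξ (h + 1) = 0) :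
    (PlaneTree.ofOffspring ξ).height ≤ h := by
  refine iSup₂_le fun n hn => ?_
  rw [← Set.encard_ne_zero, encard_generation] at hn
  by_contra hlt
  rw [Nat.cast_le, not_le] at hlt
  exact hn (by rw [genSize_eq_zero_of_le (Nat.succ_le_of_lt hlt) hh, Nat.cast_zero])

/-- A Galton-Watson process either survives or has a last positive time. -/
theorem forall_one_le_or_exists (ξ : List ℕ → ℕ) :
    (∀ n, 1 ≤ genSize ξ n) ∨ ∃ h, genSize ξ (h + 1) = 0 ∧ ∀ i ≤ h, 1 ≤ genSize ξ i := by
  by_cases hex : ∃ n, genSize ξ n = 0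
  · right
    obtain ⟨h, hh⟩ : ∃ h, Nat.find hex = h + 1 := by
      refine Nat.exists_eq_succ_of_ne_zero fun h0 => ?_
      have := Nat.find_spec hex
      rw [h0, genSize_zero] at this
      exact one_ne_zero this
    refine ⟨h, hh ▸ Nat.find_spec hex, fun i hi => Nat.one_le_iff_ne_zero.2 ?_⟩
    exact Nat.find_min hex (by omega)
  · left
    push Not at hex
    exact fun n => Nat.one_le_iff_ne_zero.2 (hex n)

/-- If the process dies out, every positive generation lies below the maximum W, and rounding W up
to a power of two costs a factor 2, whence 1024 = 2·512. If it survives, the strict inequality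
forces the width to be finite. -/
theorem exists_occupation_of_width {ξ : List ℕ → ℕ} {δ x : ℝ} (hδ : 0 < δ) (hx : 1 ≤ x)
    (h : ENNReal.ofReal (1024 * x)
      * (((PlaneTree.ofOffspring ξ).width : ℝ≥0∞) / ENNReal.ofReal δ)
        < ((PlaneTree.ofOffspring ξ).height : ℝ≥0∞)) :
    (∃ k n : ℕ, genSize ξ n = 0 ∧ 512 * x * 2 ^ k / δ ≤ occupation (genSize ξ) (2 ^ k) n) ∨
      ∃ w, ∀ n, 1 ≤ genSize ξ n ∧ genSize ξ n ≤ w := by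
  rcases forall_one_le_or_exists ξ with hall | ⟨m, hm0, hm⟩
  · right
    have hw : (PlaneTree.ofOffspring ξ).width ≠ ⊤ := by
      intro htop
      rw [htop, ENat.toENNReal_top, ENNReal.top_div_of_ne_top ENNReal.ofReal_ne_top,
        ENNReal.mul_top (by simp; linarith)] at h
      exact not_top_lt h
    obtain ⟨w, hw⟩ := ENat.ne_top_iff_exists.1 hw
    refine ⟨w, fun n => ⟨hall n, ?_⟩⟩
    have := genSize_le_width ξ n
    rw [← hw] at this
    exact_mod_cast this
  · left
    obtain ⟨i, hi, hmax⟩ := Finset.exists_max_image (Finset.range (m + 1)) (genSize ξ) ⟨0, by simp⟩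
    set W := genSize ξ i
    have hW1 : 1 ≤ W := hm i (by simpa [Nat.lt_succ_iff] using hi)
    have h2 : ENNReal.ofReal (1024 * x * (W / δ)) < ENNReal.ofReal m := by
      rw [ENNReal.ofReal_natCast]
      refine lt_of_le_of_lt ?_ (h.trans_le
        ((ENat.toENNReal_le.2 (height_le hm0)).trans_eq (ENat.toENNReal_coe m)))
      rw [ENNReal.ofReal_mul (by linarith), ENNReal.ofReal_div_of_pos hδ, ENNReal.ofReal_natCast]
      gcongr
      rw [← ENat.toENNReal_coe]
      exact ENat.toENNReal_le.2 (genSize_le_width ξ i)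
    have h3 : 1024 * x * (W / δ) < m := (ENNReal.ofReal_lt_ofReal_iff_of_nonneg
      (by positivity)).1 h2
    refine ⟨Nat.clog 2 W, m + 1, hm0, ?_⟩
    have hocc : occupation (genSize ξ) (2 ^ Nat.clog 2 W) (m + 1) = m + 1 := by
      rw [occupation, Finset.filter_true_of_mem, Finset.card_range]
      exact fun j hj => ⟨hm j (by simpa [Nat.lt_succ_iff] using hj),
        (hmax j hj).trans (Nat.le_pow_clog one_lt_two W)⟩
    have h4 : ((2 : ℝ) ^ Nat.clog 2 W) ≤ 2 * W := by exact_mod_cast pow_clog_two_le hW1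
    rw [hocc]
    push_cast
    calc 512 * x * 2 ^ Nat.clog 2 W / δ ≤ 512 * x * (2 * W) / δ := by gcongr
      _ = 1024 * x * (W / δ) := by ring
      _ ≤ m + 1 := by linarith

/-- A time not counted by the occupation contributes more than w to the sum. -/
theorem le_occupation {Z : ℕ → ℕ} {m w : ℕ} (hZ : ∀ i < m, 1 ≤ Z i) :
    m * w ≤ occupation Z w m * w + ∑ i ∈ Finset.range m, Z i := by
  induction m with
  | zero => simp
  | succ m ih =>
    have h := ih fun i hi => hZ i (by omega)
    have hm := hZ m (by omega)
    rw [occupation_succ, Finset.sum_range_succ]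
    split_ifs with hc
    · nlinarith
    · have : w < Z m := by
        by_contra hle
        exact hc ⟨hm, not_lt.1 hle⟩
      nlinarith

/-- At most half of m generations can exceed 2v/m, where v is the total size. The others give
occupation at least m/2 at a level of order v/m, and m² > (1024x)² v/δ is the required comparison.
-/
theorem exists_occupation_of_volume {ξ : List ℕ → ℕ} {δ x : ℝ} (hδ : 0 < δ) (hx : 1 ≤ x)
    (h : ENNReal.ofReal (1024 * x)
      * (((PlaneTree.ofOffspring ξ).volume : ℝ≥0∞) / ENNReal.ofReal δ) ^ (1 / 2 : ℝ)
        < ((PlaneTree.ofOffspring ξ).height : ℝ≥0∞)) :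
    ∃ k n : ℕ, genSize ξ n = 0 ∧
      512 * x ^ 2 * 2 ^ k / δ ≤ occupation (genSize ξ) (2 ^ k) n := by
  rcases forall_one_le_or_exists ξ with hall | ⟨m, hm0, hm⟩
  · exfalso
    have hv : (PlaneTree.ofOffspring ξ).volume = ⊤ := by
      refine ENat.eq_top_iff_forall_ge.2 fun n => ?_
      refine le_trans ?_ (sum_genSize_le_volume ξ n)
      rw [Nat.cast_le]
      simpa using Finset.card_nsmul_le_sum (Finset.range n) (genSize ξ) 1 fun i _ => hall i
    rw [hv, ENat.toENNReal_top, ENNReal.top_div_of_ne_top ENNReal.ofReal_ne_top,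
      ENNReal.top_rpow_of_pos (by norm_num), ENNReal.mul_top (by simp; linarith)] at h
    exact not_top_lt h
  · set v := ∑ i ∈ Finset.range (m + 1), genSize ξ i
    have hv1 : m + 1 ≤ v := by
      simpa using Finset.card_nsmul_le_sum (Finset.range (m + 1)) (genSize ξ) 1
        fun i hi => hm i (by simpa [Nat.lt_succ_iff] using hi)
    have h2 : ENNReal.ofReal (1024 * x * (v / δ) ^ (1 / 2 : ℝ)) < ENNReal.ofReal m := by
      rw [ENNReal.ofReal_natCast]
      refine lt_of_le_of_lt ?_ (h.trans_le
        ((ENat.toENNReal_le.2 (height_le hm0)).trans_eq (ENat.toENNReal_coe m)))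
      rw [ENNReal.ofReal_mul (by linarith),
        ← ENNReal.ofReal_rpow_of_nonneg (by positivity) (by norm_num),
        ENNReal.ofReal_div_of_pos hδ, ENNReal.ofReal_natCast]
      gcongr
      rw [← ENat.toENNReal_coe]
      exact ENat.toENNReal_le.2 (sum_genSize_le_volume ξ (m + 1))
    have h3 : 1024 * x * (v / δ) ^ (1 / 2 : ℝ) < m := (ENNReal.ofReal_lt_ofReal_iff_of_nonneg
      (by positivity)).1 h2
    rw [← Real.sqrt_eq_rpow] at h3
    have hm1 : (0 : ℝ) < m := lt_of_le_of_lt (by positivity) h3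
    have h4 : (1024 * x) ^ 2 * (v / δ) < m ^ 2 := by
      have := pow_lt_pow_left₀ h3 (by positivity) two_ne_zero
      rwa [mul_pow, Real.sq_sqrt (by positivity)] at this
    set z := ⌈2 * (v : ℝ) / m⌉₊
    have hvm : (m : ℝ) + 1 ≤ v := by exact_mod_cast hv1
    have hz1 : 2 * (v : ℝ) / m ≤ z := Nat.le_ceil _
    have hz2 : (z : ℝ) < 2 * v / m + 1 := Nat.ceil_lt_add_one (by positivity)
    have hv0 : (0 : ℝ) < v := by linarith
    have hz0 : 1 ≤ z := Nat.one_le_ceil_iff.2 (by positivity)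
    have h5 : ((2 : ℝ) ^ Nat.clog 2 z) ≤ 2 * z := by exact_mod_cast pow_clog_two_le hz0
    have h6 : (z : ℝ) ≤ 2 ^ Nat.clog 2 z := by exact_mod_cast Nat.le_pow_clog one_lt_two z
    refine ⟨Nat.clog 2 z, m + 1, hm0, ?_⟩
    have hocc := le_occupation (Z := genSize ξ) (m := m + 1) (w := 2 ^ Nat.clog 2 z)
      fun i hi => hm i (by omega)
    have hocc' : ((m : ℝ) + 1) * 2 ^ Nat.clog 2 z
        ≤ occupation (genSize ξ) (2 ^ Nat.clog 2 z) (m + 1) * 2 ^ Nat.clog 2 z + v := by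
      exact_mod_cast hocc
    set O := occupation (genSize ξ) (2 ^ Nat.clog 2 z) (m + 1)
    set P : ℝ := 2 ^ Nat.clog 2 z
    have hP : 0 < P := by positivity
    have h7 : 2 * (v : ℝ) ≤ P * m := (div_le_iff₀ hm1).1 (hz1.trans h6)
    have h8 : (m : ℝ) / 2 ≤ O := by
      have : 0 ≤ P * (O - m / 2) := by nlinarith
      linarith [nonneg_of_mul_nonneg_right this hP]
    have h9 : 1 ≤ v / (m : ℝ) := (one_le_div hm1).2 (by linarith)
    have h10 : P ≤ 6 * (v / m) := by
      have : 2 * (v : ℝ) / m = 2 * (v / m) := by ring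
      -- As v ≥ m, rounding up to an integer gives z ≤ 3v/m; rounding up to a power of two doubles
      -- it.
      linarith
    refine le_trans ?_ h8
    calc 512 * x ^ 2 * P / δ ≤ 512 * x ^ 2 * (6 * (v / m)) / δ := by gcongr
      _ = 3072 / (1024 ^ 2 * m) * ((1024 * x) ^ 2 * (v / δ)) := by
        field_simp
        ring
      _ ≤ 3072 / (1024 ^ 2 * m) * m ^ 2 := by gcongr
      _ = m * (3072 / 1024 ^ 2) := by field_simp
      _ ≤ m / 2 := by linarith

end GaltonWatson

/-! ### The theorem -/

open GaltonWatson in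
theorem theorem1p1 :
    ∃ C : ℝ, 0 < C ∧
      ∀ (μ : Measure ℕ) [IsProbabilityMeasure μ] (x : ℝ), 1 ≤ x →
        galtonWatson μ
            {T : PlaneTree |
              ENNReal.ofReal (C * x) * ((T.width : ℝ≥0∞) / (1 - μ {1})) < (T.height : ℝ≥0∞)}
          ≤ ENNReal.ofReal (Real.exp (-x)) ∧
        galtonWatson μ
            {T : PlaneTree |
              ENNReal.ofReal (C * x) * ((T.volume : ℝ≥0∞) / (1 - μ {1})) ^ (1 / 2 : ℝ)
                < (T.height : ℝ≥0∞)}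
          ≤ ENNReal.ofReal (Real.exp (-(x ^ 2))) := by
  refine ⟨1024, by norm_num, fun μ _ x hx => ?_⟩
  have hδe : 1 - μ {1} = ENNReal.ofReal (1 - μ.real {1}) := by
    rw [ENNReal.ofReal_sub _ measureReal_nonneg, ENNReal.ofReal_one, ofReal_measureReal]
  have hCx : ENNReal.ofReal (1024 * x) ≠ 0 := by
    simp
    linarith
  have hE1 : MeasurableSet {T : PlaneTree | ENNReal.ofReal (1024 * x)
      * ((T.width : ℝ≥0∞) / (1 - μ {1})) < (T.height : ℝ≥0∞)} :=
    measurableSet_lt ((measurable_width.div_const _).const_mul _) measurable_height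
  have hE2 : MeasurableSet {T : PlaneTree | ENNReal.ofReal (1024 * x)
      * ((T.volume : ℝ≥0∞) / (1 - μ {1})) ^ (1 / 2 : ℝ) < (T.height : ℝ≥0∞)} :=
    measurableSet_lt (((measurable_volume.div_const _).pow_const _).const_mul _) measurable_height
  rw [galtonWatson, Measure.map_apply PlaneTree.measurable_ofOffspring hE1,
    Measure.map_apply PlaneTree.measurable_ofOffspring hE2, hδe]
  have hδ0 : 0 ≤ 1 - μ.real {1} := sub_nonneg.2 measureReal_le_one
  rcases hδ0.eq_or_lt with hδ | hδ
  -- If μ(1) = 1, the quotients are infinite because width and volume are at least 1, so both events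
  -- are empty.
  · rw [← hδ, ENNReal.ofReal_zero]
    have hone : ∀ ξ : List ℕ → ℕ, (1 : ℕ∞) ≤ (PlaneTree.ofOffspring ξ).width := fun ξ => by
      simpa [genSize_zero] using genSize_le_width ξ 0
    have hone' : ∀ ξ : List ℕ → ℕ, (1 : ℕ∞) ≤ (PlaneTree.ofOffspring ξ).volume := fun ξ => by
      simpa [genSize_zero] using sum_genSize_le_volume ξ 1
    constructor
    · refine (measure_mono_null (fun ξ hξ => ?_) measure_empty).trans_le zero_le
      have hne : ((PlaneTree.ofOffspring ξ).width : ℝ≥0∞) ≠ 0 := by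
        rw [Ne, ENat.toENNReal_eq_zero]
        exact (zero_lt_one.trans_le (hone ξ)).ne'
      rw [Set.mem_preimage, Set.mem_ofPred_eq, ENNReal.div_zero hne, ENNReal.mul_top hCx] at hξ
      exact not_top_lt hξ
    · refine (measure_mono_null (fun ξ hξ => ?_) measure_empty).trans_le zero_le
      have hne : ((PlaneTree.ofOffspring ξ).volume : ℝ≥0∞) ≠ 0 := by
        rw [Ne, ENat.toENNReal_eq_zero]
        exact (zero_lt_one.trans_le (hone' ξ)).ne'
      rw [Set.mem_preimage, Set.mem_ofPred_eq, ENNReal.div_zero hne,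
        ENNReal.top_rpow_of_pos (by norm_num), ENNReal.mul_top hCx] at hξ
      exact not_top_lt hξ
  · constructor
    · have hnull : offspringLaw μ (⋃ w, {ξ | ∀ n, 1 ≤ genSize ξ n ∧ genSize ξ n ≤ w}) = 0 :=
        measure_iUnion_null fun w => measure_forall_genSize_mem hδ w
      refine (measure_mono fun ξ hξ => ?_).trans ((measure_union_le _ _).trans
        ((add_le_add (measure_exists_occupation_le hδ hx) hnull.le).trans_eq (add_zero _)))
      rcases exists_occupation_of_width hδ hx hξ with h | ⟨w, h⟩
      · exact Or.inl h
      · exact Or.inr (Set.mem_iUnion.2 ⟨w, h⟩)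
    -- The occupation bound is used with x² in place of x.
    · exact (measure_mono fun ξ hξ => exists_occupation_of_volume hδ hx hξ).trans
        (measure_exists_occupation_le hδ (one_le_pow₀ hx))
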